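/- Let $\tau$ be in the upper half-plane, let $z\in\mathbb{C}$ with $z\notin\mathbb{Z}+\mathbb{Z}\tau$, and put $q=e^{2\pi i\tau}$, $y=e^{2\pi i z}$, $q^{1/8}=e^{2\pi i\tau/8}$, $q^{1/24}=e^{2\pi i\tau/24}$, $y^{\pm1/2}=e^{\pm\pi i z}$. Define $$\theta_1(\tau,z)= i\,q^{1/8}y^{-1/2}\prod_{n=1}^\infty(1-q^n)(1-q^{n-1}y)(1-q^n y^{-1}),\qquad \eta(\tau)=q^{1/24}\prod_{n=1}^\infty(1-q^n),$$ $$\mu(\tau,z)=\frac{-i\,y^{1/2}}{\theta_1(\tau,z)}\sum_{\ell\in\mathbb{Z}}\frac{(-1)^\ell y^\ell q^{\ell(\ell+1)/2}}{1-y\,q^\ell},\qquad F_2^{(2)}(\tau)=\sum_{\substack{r>s>0\\ r-s\ \mathrm{odd}}}(-1)^r\,s\,q^{rs/2},$$ where $r,s$ are integers, and $$s_1(\tau,z)=\frac{\theta_1(\tau,z)}{\eta(\tau)^3}\sum_{i\in\mathbb{Z}}\frac{1}{(1-y\,q^i)(1-y^{-1}q^{-i})}.$$ Then the product for $\theta_1(\tau,z)$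 converges and $\theta_1(\tau,z)\neq0$, the series defining $s_1$, $\mu$ and $F_2^{(2)}$ converge absolutely, and $$s_1(\tau,z)=\frac{\theta_1(\tau,z)}{\eta(\tau)^3}\,2F_2^{(2)}(\tau)+\theta_1(\tau,z)\,\mu(\tau,z).$$ -/

import Mathlib

noncomputable section

namespace HodgeElliptic

open Complex UpperHalfPlane

/-- The nome `q = e^{2πiτ}`. -/
def q (τ : ℍ) : ℂ := cexp (2 * Real.pi * Complex.I * (τ : ℂ))

/-- The elliptic variable `y = e^{2πiz}`. -/
def y (z : ℂ) : ℂ := cexp (2 * Real.pi * Complex.I * z)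

/-- The factor of index `n + 1` in the product for `θ₁`:
`(1 - q^{n+1}) (1 - q^n y) (1 - q^{n+1} y⁻¹)`, for `n = 0, 1, 2, …`. -/
def thetaFactor (τ : ℍ) (z : ℂ) (n : ℕ) : ℂ :=
  (1 - q τ ^ (n + 1)) * (1 - q τ ^ n * y z) * (1 - q τ ^ (n + 1) * (y z)⁻¹)

/-- `θ₁(τ,z) = i q^{1/8} y^{-1/2} ∏_{n ≥ 1} (1 - qⁿ)(1 - q^{n-1} y)(1 - qⁿ y⁻¹)`, where
`q^{1/8} = e^{2πiτ/8}` and `y^{-1/2} = e^{-πiz}`. -/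
def theta1 (τ : ℍ) (z : ℂ) : ℂ :=
  Complex.I * cexp (2 * Real.pi * Complex.I * (τ : ℂ) / 8) * cexp (-(Real.pi * Complex.I * z)) *
    ∏' n : ℕ, thetaFactor τ z n

/-- The `ℓ`-th term of the Appell–Lerch sum. The product `ℓ (ℓ + 1)` is even, so the integer
division by `2` is exact. -/
def appellLerchTerm (τ : ℍ) (z : ℂ) (l : ℤ) : ℂ :=
  (-1) ^ l * y z ^ l * q τ ^ (l * (l + 1) / 2) / (1 - y z * q τ ^ l)

/-- The Appell–Lerch sum
`μ(τ,z) = (-i y^{1/2} / θ₁(τ,z)) ∑_{ℓ ∈ ℤ} (-1)^ℓ y^ℓ q^{ℓ(ℓ+1)/2} / (1 - y q^ℓ)`, where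
`y^{1/2} = e^{πiz}`. -/
def mu (τ : ℍ) (z : ℂ) : ℂ :=
  -Complex.I * cexp (Real.pi * Complex.I * z) / theta1 τ z * ∑' l : ℤ, appellLerchTerm τ z l

/-- Pairs `(r, s)` of natural numbers with `r > s > 0` and `r - s` odd. -/
def OddGapPair : Type :=
  {p : ℕ × ℕ // 0 < p.2 ∧ p.2 < p.1 ∧ Odd (p.1 - p.2)}

/-- The term `(-1)^r s q^{rs/2}`. One of `r`, `s` is even, so the division by `2` is exact. -/
def f22Term (τ : ℍ) (p : OddGapPair) : ℂ :=
  (-1) ^ p.1.1 * (p.1.2 : ℂ) * q τ ^ (p.1.1 * p.1.2 / 2)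

/-- `F₂⁽²⁾(τ) = ∑_{r > s > 0, r - s odd} (-1)^r s q^{rs/2} = q + q² - q³ + q⁴ - ⋯`. -/
def F22 (τ : ℍ) : ℂ := ∑' p : OddGapPair, f22Term τ p

/-- The `i`-th term `1 / ((1 - y q^i) (1 - y⁻¹ q^{N-1-i}))` of the series for `s_N`. -/
def sTerm (N : ℤ) (τ : ℍ) (z : ℂ) (i : ℤ) : ℂ :=
  1 / ((1 - y z * q τ ^ i) * (1 - (y z)⁻¹ * q τ ^ (N - 1 - i)))

/-- `s_N(τ,z) = (θ₁(τ,z) / η(τ)³) ∑_{i ∈ ℤ} 1 / ((1 - y q^i) (1 - y⁻¹ q^{N-1-i}))`, with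
Mathlib's Dedekind eta function. -/
def s (N : ℤ) (τ : ℍ) (z : ℂ) : ℂ :=
  theta1 τ z / ModularForm.eta (τ : ℂ) ^ 3 * ∑' i : ℤ, sTerm N τ z i

end HodgeElliptic

end

noncomputable section

namespace AppellLerch

open Filter Topology

/-! Write θ(y) for the theta series with coefficients `thetaCoeff q k`, S(y) for the double-pole
sum, A(y) for the Appell–Lerch sum and φ for `eulerProd q`. After the triple product identity and η³
= q^{1/8} φ³, the claim becomes θ(y) (S(y) − 2 F₂⁽²⁾) = −φ³ y A(y).

In the annulus |q| < |y| < 1 everything expands in powers of y. The coefficients a_n of y A satisfy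
a_n + q^{n−1} a_{n−1} = 1 with a_0 = 0 (`tsum_appellCoeff_add`). The coefficients c_n of θ S satisfy
the same recurrence with right-hand side −φ³ (`convCoeff_add`); this constant comes from θ(1) = 0
and Jacobi's identity ∑ k `thetaCoeff q k` = −φ³. Since `thetaCoeff` solves the homogeneous
recurrence and equals 1 at 0, it follows that c_n − c_0 `thetaCoeff q n` = −φ³ a_n
(`convCoeff_sub`). Expanding geometric series identifies c_0 with 2 F₂⁽²⁾ (`convCoeff_zero`).

The identity extends to |y| = 1, y ≠ 1, by a radial limit, and then to all y outside q^ℤ because y ↦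
qy multiplies both sides by −y⁻¹ (`appellIdentity`). Both Jacobi identities are limits of a finite
triple product with explicit coefficients. -/

/-! ### Theta coefficients and the finite triple product -/

/-- The coefficient `(-1)^k q^{k(k-1)/2}` of `y^k` in Jacobi's theta series. -/
def thetaCoeff (q : ℂ) (k : ℤ) : ℂ := (-1) ^ k * q ^ (k * (k - 1) / 2)

/-- The finite product `(1 - q)(1 - q²)⋯(1 - qⁿ)`. -/
def qPoch (q : ℂ) (n : ℕ) : ℂ := ∏ i ∈ Finset.range n, (1 - q ^ (i + 1))

/-- The reciprocal of `qPoch q m`, extended by zero to negative `m`. -/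
def qPochInv (q : ℂ) (m : ℤ) : ℂ := if m < 0 then 0 else (qPoch q m.toNat)⁻¹

/-- The coefficient of `y^k` in `∏_{n < N} (1 - qⁿ y)(1 - q^{n+1} y⁻¹)`. -/
def finiteThetaCoeff (q : ℂ) (N : ℕ) (k : ℤ) : ℂ :=
  thetaCoeff q k * (qPoch q (2 * N) * qPochInv q (N - k) * qPochInv q (N + k))

lemma _root_.HasSum.of_eq {ι : Type*} {f g : ι → ℂ} {a b : ℂ} (h : HasSum f a) (hfg : ∀ i, g i = f i)
    (hab : b = a) : HasSum g b := by
  rw [hab, show g = f from funext hfg]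
  exact h

lemma triangle_succ (k : ℤ) : (k + 1) * (k + 1 - 1) / 2 = k * (k - 1) / 2 + k := by
  rw [show (k + 1) * (k + 1 - 1) = k * (k - 1) + 2 * k by ring,
    Int.add_mul_ediv_left _ _ (by norm_num)]

lemma thetaCoeff_zero (q : ℂ) : thetaCoeff q 0 = 1 := by simp [thetaCoeff]

lemma thetaCoeff_succ {q : ℂ} (hq : q ≠ 0) (k : ℤ) :
    thetaCoeff q (k + 1) = -q ^ k * thetaCoeff q k := by
  rw [thetaCoeff, thetaCoeff, triangle_succ, zpow_add₀ hq, zpow_add₀ (by norm_num)]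
  simp; ring

lemma thetaCoeff_pred {q : ℂ} (hq : q ≠ 0) (k : ℤ) :
    thetaCoeff q k = -q ^ (k - 1) * thetaCoeff q (k - 1) := by
  simpa using thetaCoeff_succ hq (k - 1)

lemma thetaCoeff_neg {q : ℂ} (hq : q ≠ 0) (k : ℤ) :
    thetaCoeff q (-k) = thetaCoeff q k * q ^ k := by
  have h : -k * (-k - 1) / 2 = k * (k - 1) / 2 + k := by
    rw [← triangle_succ]; ring_nf
  rw [thetaCoeff, thetaCoeff, h, zpow_add₀ hq, zpow_neg, ← inv_zpow]
  norm_num; ring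

lemma norm_lt_one_pow_ne_one {q : ℂ} (h1 : ‖q‖ < 1) (n : ℕ) : 1 - q ^ (n + 1) ≠ 0 := by
  intro h
  have h2 : ‖q ^ (n + 1)‖ = 1 := by rw [← sub_eq_zero.1 h]; simp
  rw [norm_pow] at h2
  exact absurd h2 (pow_lt_one₀ (norm_nonneg _) h1 (by simp)).ne

lemma qPoch_succ (q : ℂ) (n : ℕ) : qPoch q (n + 1) = qPoch q n * (1 - q ^ (n + 1)) :=
  Finset.prod_range_succ _ _

lemma qPoch_ne_zero {q : ℂ} (h1 : ‖q‖ < 1) (n : ℕ) : qPoch q n ≠ 0 :=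
  Finset.prod_ne_zero_iff.2 fun i _ => norm_lt_one_pow_ne_one h1 i

/-- Extension by zero is consistent at m = 0 because 1 − q⁰ = 0. Hence the coefficient recurrence
needs no boundary cases, although the finite theta coefficients vanish for |k| > N. -/
lemma qPochInv_sub_one {q : ℂ} (h1 : ‖q‖ < 1) (m : ℤ) :
    qPochInv q (m - 1) = (1 - q ^ m) * qPochInv q m := by
  rcases lt_trichotomy m 0 with h | rfl | h
  · simp [qPochInv, h, show m - 1 < 0 by lia]
  · simp [qPochInv]
  · obtain ⟨n, rfl⟩ : ∃ n : ℕ, m = n + 1 := ⟨(m - 1).toNat, by lia⟩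
    have h2 := norm_lt_one_pow_ne_one h1 n
    have h3 := qPoch_ne_zero h1 n
    simp only [qPochInv, add_sub_cancel_right, show ¬ ((n : ℤ) < 0) by lia,
      show ¬ ((n : ℤ) + 1 < 0) by lia, if_false, show ((n : ℤ) + 1).toNat = n + 1 by lia,
      Int.toNat_natCast, qPoch_succ]
    rw [show q ^ ((n : ℤ) + 1) = q ^ (n + 1) by exact_mod_cast rfl]
    field_simp

lemma finiteThetaCoeff_zero (q : ℂ) (k : ℤ) :
    finiteThetaCoeff q 0 k = if k = 0 then 1 else 0 := by
  rcases lt_trichotomy k 0 with h | rfl | h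
  · simp [finiteThetaCoeff, qPochInv, h, h.ne]
  · simp [finiteThetaCoeff, qPochInv, thetaCoeff_zero, qPoch]
  · simp [finiteThetaCoeff, qPochInv, h, h.ne']

/-- Comparison of coefficients after multiplying by the new factor (1 − q^N y)(1 − q^{N+1} y⁻¹) = 1
+ q^{2N+1} − q^N y − q^{N+1} y⁻¹. -/
lemma finiteThetaCoeff_succ {q : ℂ} (hq : q ≠ 0) (h1 : ‖q‖ < 1) (N : ℕ) (k : ℤ) :
    finiteThetaCoeff q (N + 1) k = (1 + q ^ (2 * N + 1)) * finiteThetaCoeff q N k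
      - q ^ N * finiteThetaCoeff q N (k - 1) - q ^ (N + 1) * finiteThetaCoeff q N (k + 1) := by
  have e1 : qPochInv q (N - k) = (1 - q ^ ((N : ℤ) + 1 - k)) * qPochInv q (N + 1 - k) := by
    rw [← qPochInv_sub_one h1]; ring_nf
  have e2 : qPochInv q (N - (k + 1)) = (1 - q ^ ((N : ℤ) - k)) * qPochInv q (N - k) := by
    rw [← qPochInv_sub_one h1]; ring_nf
  have e3 : qPochInv q (N + k) = (1 - q ^ ((N : ℤ) + 1 + k)) * qPochInv q (N + 1 + k) := by
    rw [← qPochInv_sub_one h1]; ring_nf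
  have e4 : qPochInv q (N + (k - 1)) = (1 - q ^ ((N : ℤ) + k)) * qPochInv q (N + k) := by
    rw [← qPochInv_sub_one h1]; ring_nf
  have t1 := thetaCoeff_succ hq k
  have t2 : thetaCoeff q (k - 1) = - (q ^ k)⁻¹ * q * thetaCoeff q k := by
    have := zpow_ne_zero k hq
    rw [thetaCoeff_pred hq k, zpow_sub_one₀ hq]; field_simp
  simp only [finiteThetaCoeff]
  rw [e2, e4, show (N : ℤ) - (k - 1) = N + 1 - k by ring,
    show (N : ℤ) + (k + 1) = N + 1 + k by ring, e1, e3, t1, t2,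
    show 2 * (N + 1) = 2 * N + 1 + 1 by ring, qPoch_succ, qPoch_succ]
  push_cast
  simp only [zpow_add₀ hq, zpow_sub₀ hq, zpow_natCast, zpow_one]
  have := zpow_ne_zero k hq
  field_simp
  ring

lemma hasSum_finiteTheta {q y : ℂ} (hq : q ≠ 0) (h1 : ‖q‖ < 1) (hy : y ≠ 0) (N : ℕ) :
    HasSum (fun k : ℤ => finiteThetaCoeff q N k * y ^ k)
      (∏ n ∈ Finset.range N, (1 - q ^ n * y) * (1 - q ^ (n + 1) * y⁻¹)) := by
  induction N with
  | zero =>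
    refine (hasSum_ite_eq (0 : ℤ) (1 : ℂ)).of_eq (fun k => ?_) (by simp)
    rw [finiteThetaCoeff_zero]
    split_ifs with h <;> simp [h]
  | succ N ih =>
    rw [Finset.prod_range_succ]
    have a1 := ((Equiv.subRight (1 : ℤ)).hasSum_iff.2 ih).mul_left (q ^ N * y)
    have a2 := ((Equiv.addRight (1 : ℤ)).hasSum_iff.2 ih).mul_left (q ^ (N + 1) * y⁻¹)
    refine (((ih.mul_left (1 + q ^ (2 * N + 1))).sub a1).sub a2).of_eq (fun k => ?_) ?_
    · simp only [finiteThetaCoeff_succ hq h1, Function.comp, Equiv.subRight_apply,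
        Equiv.coe_addRight, zpow_sub_one₀ hy, zpow_add_one₀ hy]
      field_simp
    · have : y * y⁻¹ = 1 := mul_inv_cancel₀ hy
      linear_combination (∏ n ∈ Finset.range N, (1 - q ^ n * y) * (1 - q ^ (n + 1) * y⁻¹)) *
        q ^ (2 * N + 1) * this

/-- The logarithmic derivative at `y = 1` of the finite theta product. -/
lemma hasSum_mul_finiteThetaCoeff {q : ℂ} (hq : q ≠ 0) (h1 : ‖q‖ < 1) (N : ℕ) :
    HasSum (fun k : ℤ => (k : ℂ) * finiteThetaCoeff q (N + 1) k) (-(qPoch q N * qPoch q (N + 1))) := by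
  -- This is the product rule for y d/dy at y = 1: Z is the value of the finite product there and D
  -- its derivative.
  have step : ∀ (N : ℕ) (Z D : ℂ), HasSum (finiteThetaCoeff q N) Z →
      HasSum (fun k : ℤ => (k : ℂ) * finiteThetaCoeff q N k) D →
      HasSum (fun k : ℤ => (k : ℂ) * finiteThetaCoeff q (N + 1) k)
        ((1 - q ^ N) * (1 - q ^ (N + 1)) * D - (q ^ N - q ^ (N + 1)) * Z) := by
    intro N Z D hZ hD
    have z1 := ((Equiv.subRight (1 : ℤ)).hasSum_iff.2 hZ)
    have z2 := ((Equiv.addRight (1 : ℤ)).hasSum_iff.2 hZ)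
    have d1 := ((Equiv.subRight (1 : ℤ)).hasSum_iff.2 hD)
    have d2 := ((Equiv.addRight (1 : ℤ)).hasSum_iff.2 hD)
    refine (((hD.mul_left (1 + q ^ (2 * N + 1))).sub ((d1.add z1).mul_left (q ^ N))).sub
      ((d2.sub z2).mul_left (q ^ (N + 1)))).of_eq (fun k => ?_) ?_
    · simp only [finiteThetaCoeff_succ hq h1, Function.comp, Equiv.subRight_apply,
        Equiv.coe_addRight]
      push_cast
      ring
    · ring
  have hZ : ∀ N, HasSum (finiteThetaCoeff q N) _ := fun N => by
    simpa using hasSum_finiteTheta hq h1 one_ne_zero N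
  induction N with
  | zero =>
    have h0 : HasSum (fun k : ℤ => (k : ℂ) * finiteThetaCoeff q 0 k) 0 := by
      refine hasSum_zero.of_eq (fun k => ?_) rfl
      rw [finiteThetaCoeff_zero]; split_ifs with h <;> simp [h]
    refine (step 0 _ _ (hZ 0) h0).of_eq (fun _ => rfl) ?_
    simp [qPoch]
  | succ N ih =>
    refine (step (N + 1) _ _ (hZ (N + 1)) ih).of_eq (fun _ => rfl) ?_
    -- Splitting off the factor of index 0, which is 1 − y, shows that the value Z vanishes at y =
    -- 1.
    rw [Finset.prod_range_succ']
    simp [qPoch_succ]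
    ring

/-! ### Limits of the finite identities: Jacobi's triple product and cube -/

/-- The infinite product `∏_{n ≥ 1} (1 - qⁿ)`. -/
def eulerProd (q : ℂ) : ℂ := ∏' n : ℕ, (1 - q ^ (n + 1))

lemma eulerProd_ne_zero {q : ℂ} (h1 : ‖q‖ < 1) : eulerProd q ≠ 0 := by
  refine tprod_one_add_ne_zero_of_summable (f := fun n => -q ^ (n + 1)) (fun n => ?_) ?_
  · simpa [sub_eq_add_neg] using norm_lt_one_pow_ne_one h1 n
  · simpa using (summable_nat_add_iff 1).mpr (summable_geometric_of_lt_one (norm_nonneg _) h1)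

lemma tendsto_qPoch {q : ℂ} (h1 : ‖q‖ < 1) : Tendsto (qPoch q) atTop (𝓝 (eulerProd q)) :=
  (ModularForm.multipliable_one_sub_pow h1).hasProd.tendsto_prod_nat

lemma tendsto_qPochInv {q : ℂ} (h1 : ‖q‖ < 1) :
    Tendsto (qPochInv q) atTop (𝓝 (eulerProd q)⁻¹) := by
  have ht : Tendsto Int.toNat atTop atTop := tendsto_atTop.2 fun b => by
    filter_upwards [eventually_ge_atTop (b : ℤ)] with m hm
    lia
  have h := ((tendsto_qPoch h1).inv₀ (eulerProd_ne_zero h1)).comp ht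
  refine h.congr' ?_
  filter_upwards [eventually_ge_atTop 0] with m hm
  simp [qPochInv, hm.not_gt]

lemma exists_norm_qPoch_le {q : ℂ} (h1 : ‖q‖ < 1) : ∃ C, ∀ n, ‖qPoch q n‖ ≤ C := by
  obtain ⟨C, hC⟩ := (tendsto_qPoch h1).norm.bddAbove_range
  exact ⟨C, fun n => hC ⟨n, rfl⟩⟩

lemma exists_norm_qPochInv_le {q : ℂ} (h1 : ‖q‖ < 1) : ∃ C, ∀ m, ‖qPochInv q m‖ ≤ C := by
  obtain ⟨C, hC⟩ := ((tendsto_qPoch h1).inv₀ (eulerProd_ne_zero h1)).norm.bddAbove_range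
  refine ⟨C, fun m => ?_⟩
  have hn : ∀ n, ‖(qPoch q n)⁻¹‖ ≤ C := fun n => hC ⟨n, rfl⟩
  rw [qPochInv]
  split_ifs
  · simpa using (norm_nonneg _).trans (hn 0)
  · exact hn _

/-- Tannery's theorem: the three q-product factors are bounded uniformly in N and k, and for fixed k
they tend to φ · φ⁻¹ · φ⁻¹. Weights w k = y^k and w k = k give the two Jacobi identities. -/
lemma tendsto_tsum_mul_finiteThetaCoeff {q : ℂ} (h1 : ‖q‖ < 1) {w : ℤ → ℂ}
    (hw : Summable fun k => ‖w k * thetaCoeff q k‖) :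
    Tendsto (fun N : ℕ => ∑' k, w k * finiteThetaCoeff q N k) atTop
      (𝓝 ((∑' k, w k * thetaCoeff q k) * (eulerProd q)⁻¹)) := by
  obtain ⟨C, hC⟩ := exists_norm_qPoch_le h1
  obtain ⟨D, hD⟩ := exists_norm_qPochInv_le h1
  have hC0 : 0 ≤ C := (norm_nonneg _).trans (hC 0)
  have hD0 : 0 ≤ D := (norm_nonneg _).trans (hD 0)
  rw [← tsum_mul_right]
  refine tendsto_tsum_of_dominated_convergence (hw.mul_right (C * D * D)) (fun k => ?_)
    (.of_forall fun N k => ?_)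
  · have h2 : Tendsto (fun N : ℕ => 2 * N) atTop atTop :=
      tendsto_id.const_mul_atTop' (by norm_num)
    have hs : Tendsto (fun N : ℕ => (N : ℤ) - k) atTop atTop :=
      tendsto_atTop_add_const_right _ (-k) tendsto_natCast_atTop_atTop
    have ha : Tendsto (fun N : ℕ => (N : ℤ) + k) atTop atTop :=
      tendsto_atTop_add_const_right _ k tendsto_natCast_atTop_atTop
    have h := (((tendsto_qPoch h1).comp h2).mul ((tendsto_qPochInv h1).comp hs)).mul
      ((tendsto_qPochInv h1).comp ha)
    rw [mul_inv_cancel₀ (eulerProd_ne_zero h1), one_mul] at h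
    refine (h.const_mul (w k * thetaCoeff q k)).congr fun N => ?_
    simp only [finiteThetaCoeff, Function.comp]
    ring
  · rw [finiteThetaCoeff, ← mul_assoc, norm_mul]
    gcongr
    rw [norm_mul, norm_mul]
    gcongr
    exacts [hC _, hD _, hD _]

lemma summable_norm_thetaCoeff_nat {q : ℂ} (hq : q ≠ 0) (h1 : ‖q‖ < 1) {ρ : ℝ} (hρ : 0 < ρ) :
    Summable fun n : ℕ => ‖thetaCoeff q n‖ * ρ ^ n := by
  have hne : ∀ n : ℕ, 0 < ‖thetaCoeff q n‖ := fun n =>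
    norm_pos_iff.2 (mul_ne_zero (zpow_ne_zero _ (by norm_num)) (zpow_ne_zero _ hq))
  refine summable_of_ratio_test_tendsto_lt_one (l := 0) zero_lt_one
    (.of_forall fun n => (mul_pos (hne n) (pow_pos hρ n)).ne') ?_
  have h := (tendsto_pow_atTop_nhds_zero_of_lt_one (norm_nonneg q) h1).mul_const ρ
  rw [zero_mul] at h
  refine h.congr fun n => ?_
  have := (hne n).ne'
  have := (pow_pos hρ n).ne'
  push_cast
  rw [Real.norm_of_nonneg (by positivity), Real.norm_of_nonneg (by positivity),
    thetaCoeff_succ hq, norm_mul, norm_neg, zpow_natCast, norm_pow, pow_succ]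
  field_simp

/-- The theta series converges absolutely at every nonzero point. -/
lemma summable_norm_thetaCoeff {q : ℂ} (hq : q ≠ 0) (h1 : ‖q‖ < 1) {ρ : ℝ} (hρ : 0 < ρ) :
    Summable fun k : ℤ => ‖thetaCoeff q k‖ * ρ ^ k := by
  refine Summable.of_nat_of_neg ?_ ?_
  · simpa using summable_norm_thetaCoeff_nat hq h1 hρ
  -- The reflection k ↦ −k contributes q^k, so the negative half at ρ is the positive half at ‖q‖ /
  -- ρ.
  · refine (summable_norm_thetaCoeff_nat hq h1 (div_pos (norm_pos_iff.2 hq) hρ)).congr fun n => ?_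
    rw [thetaCoeff_neg hq, norm_mul, zpow_natCast, norm_pow, zpow_neg, zpow_natCast, div_pow]
    ring

lemma summable_norm_theta {q y : ℂ} (hq : q ≠ 0) (h1 : ‖q‖ < 1) (hy : y ≠ 0) :
    Summable fun k : ℤ => ‖thetaCoeff q k * y ^ k‖ := by
  simpa [norm_mul, norm_zpow] using summable_norm_thetaCoeff hq h1 (norm_pos_iff.2 hy)

lemma summable_norm_mul_thetaCoeff {q : ℂ} (hq : q ≠ 0) (h1 : ‖q‖ < 1) :
    Summable fun k : ℤ => ‖(k : ℂ) * thetaCoeff q k‖ := by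
  -- The weight is absorbed through |k| ≤ 2^k + 2^{−k}.
  refine Summable.of_nonneg_of_le (fun _ => norm_nonneg _) (fun k => ?_)
    ((summable_norm_thetaCoeff hq h1 (ρ := 2) two_pos).add
      (summable_norm_thetaCoeff hq h1 (ρ := 2⁻¹) (by norm_num)))
  rw [norm_mul, mul_comm, ← mul_add]
  gcongr
  rw [Complex.norm_intCast, inv_zpow']
  obtain ⟨n, rfl | rfl⟩ := k.eq_nat_or_neg
  · have : (n : ℝ) < 2 ^ n := by exact_mod_cast Nat.lt_two_pow_self
    simp only [Int.cast_natCast, Nat.abs_cast, zpow_natCast]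
    linarith [zpow_pos (two_pos : (0 : ℝ) < 2) (-(n : ℤ))]
  · have : (n : ℝ) < 2 ^ n := by exact_mod_cast Nat.lt_two_pow_self
    simp only [Int.cast_neg, abs_neg, neg_neg, Int.cast_natCast, Nat.abs_cast, zpow_natCast]
    linarith [zpow_pos (two_pos : (0 : ℝ) < 2) (-(n : ℤ))]

lemma summable_norm_geometric_mul {q : ℂ} (h1 : ‖q‖ < 1) (a : ℂ) :
    Summable fun n : ℕ => ‖-(q ^ n * a)‖ := by
  simpa [norm_mul, norm_pow] using (summable_geometric_of_lt_one (norm_nonneg _) h1).mul_right ‖a‖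

lemma multipliable_one_sub_pow_mul {q : ℂ} (h1 : ‖q‖ < 1) (a : ℂ) :
    Multipliable fun n : ℕ => 1 - q ^ n * a := by
  simpa [sub_eq_add_neg] using multipliable_one_add_of_summable (summable_norm_geometric_mul h1 a)

lemma multipliable_one_sub_pow_succ_mul {q : ℂ} (h1 : ‖q‖ < 1) (a : ℂ) :
    Multipliable fun n : ℕ => 1 - q ^ (n + 1) * a := by
  simpa [pow_succ, mul_assoc] using multipliable_one_sub_pow_mul h1 (q * a)

/-- Jacobi's triple product identity. -/
theorem tripleProduct {q y : ℂ} (hq : q ≠ 0) (h1 : ‖q‖ < 1) (hy : y ≠ 0) :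
    ∏' n : ℕ, (1 - q ^ (n + 1)) * (1 - q ^ n * y) * (1 - q ^ (n + 1) * y⁻¹) =
      ∑' k : ℤ, thetaCoeff q k * y ^ k := by
  have hm := (multipliable_one_sub_pow_mul h1 y).mul (multipliable_one_sub_pow_succ_mul h1 y⁻¹)
  have hw : Summable fun k : ℤ => ‖y ^ k * thetaCoeff q k‖ := by
    simpa only [mul_comm] using summable_norm_theta hq h1 hy
  have h2 := tendsto_tsum_mul_finiteThetaCoeff h1 hw
  have h3 := tendsto_nhds_unique h2 (hm.hasProd.tendsto_prod_nat.congr fun N => by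
    rw [← (hasSum_finiteTheta hq h1 hy N).tsum_eq]
    exact tsum_congr fun k => mul_comm _ _)
  simp only [mul_assoc]
  rw [(ModularForm.multipliable_one_sub_pow h1).tprod_mul hm, ← h3]
  have := eulerProd_ne_zero h1
  rw [← eulerProd, tsum_congr fun k => mul_comm (y ^ k) (thetaCoeff q k)]
  field_simp

/-- Jacobi's identity for the cube of Euler's product. -/
theorem tsum_mul_thetaCoeff {q : ℂ} (hq : q ≠ 0) (h1 : ‖q‖ < 1) :
    ∑' k : ℤ, (k : ℂ) * thetaCoeff q k = -eulerProd q ^ 3 := by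
  have h2 := (tendsto_tsum_mul_finiteThetaCoeff h1 (summable_norm_mul_thetaCoeff hq h1)).comp
    (tendsto_add_atTop_nat 1)
  have h4 := ((tendsto_qPoch h1).mul ((tendsto_qPoch h1).comp (tendsto_add_atTop_nat 1))).neg
  have h3 := tendsto_nhds_unique h2 (h4.congr fun N =>
    (hasSum_mul_finiteThetaCoeff hq h1 N).tsum_eq.symm)
  have := eulerProd_ne_zero h1
  field_simp at h3
  exact h3

lemma tsum_thetaCoeff {q : ℂ} (hq : q ≠ 0) (h1 : ‖q‖ < 1) : ∑' k : ℤ, thetaCoeff q k = 0 := by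
  have h := tripleProduct hq h1 one_ne_zero
  simp only [one_zpow, mul_one] at h
  rw [← h]
  exact tprod_of_exists_eq_zero ⟨0, by simp⟩

/-! ### The two sums and their behaviour under y ↦ qy -/

/-- The `l`-th term `(-1)^l y^l q^{l(l+1)/2} / (1 - y q^l)` of the Appell–Lerch sum. -/
def appellTerm (q y : ℂ) (l : ℤ) : ℂ :=
  (-1) ^ l * y ^ l * q ^ (l * (l + 1) / 2) / (1 - y * q ^ l)

/-- The term `1 / ((1 - y q^i)(1 - y⁻¹ q^{-i}))`, an elliptic summand with a double pole. -/
def poleTerm (q y : ℂ) (i : ℤ) : ℂ := 1 / ((1 - y * q ^ i) * (1 - y⁻¹ * q ^ (-i)))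

lemma appellTerm_eq {q : ℂ} (hq : q ≠ 0) (y : ℂ) (l : ℤ) :
    appellTerm q y l = thetaCoeff q l * q ^ l * y ^ l / (1 - y * q ^ l) := by
  have h : l * (l + 1) / 2 = l * (l - 1) / 2 + l := by
    rw [← triangle_succ]; ring_nf
  rw [appellTerm, thetaCoeff, h, zpow_add₀ hq]
  ring

lemma poleTerm_eq {q y : ℂ} (hq : q ≠ 0) (hy : y ≠ 0) (i : ℤ) :
    poleTerm q y i = -(y * q ^ i) / (1 - y * q ^ i) ^ 2 := by
  have h0 : y * q ^ i ≠ 0 := mul_ne_zero hy (zpow_ne_zero _ hq)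
  rw [poleTerm, zpow_neg, ← mul_inv]
  generalize y * q ^ i = u at *
  by_cases h : 1 - u = 0
  · simp [h]
  · rw [show 1 - u⁻¹ = -(1 - u) / u by field_simp; ring]
    field_simp

/-- The summand is symmetric under u ↦ u⁻¹ with u = y q^i. This form serves the negative indices,
where u⁻¹ is the small quantity. -/
lemma poleTerm_eq_inv {q y : ℂ} (hq : q ≠ 0) (hy : y ≠ 0) (i : ℤ) :
    poleTerm q y i = -(y * q ^ i)⁻¹ / (1 - (y * q ^ i)⁻¹) ^ 2 := by
  have h0 : y * q ^ i ≠ 0 := mul_ne_zero hy (zpow_ne_zero _ hq)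
  rw [poleTerm, zpow_neg, ← mul_inv]
  generalize y * q ^ i = u at *
  by_cases h : 1 - u = 0
  · simp [← sub_eq_zero.1 h]
  · rw [show 1 - u⁻¹ = -(1 - u) / u by field_simp; ring]
    field_simp

lemma appellTerm_mul {q y : ℂ} (hq : q ≠ 0) (hy : y ≠ 0) (l : ℤ) :
    appellTerm q (q * y) l = -(y * q)⁻¹ * appellTerm q y (l + 1) := by
  rw [appellTerm_eq hq, appellTerm_eq hq, thetaCoeff_succ hq, mul_zpow, zpow_add_one₀ hq,
    zpow_add_one₀ hy, show q * y * q ^ l = y * (q ^ l * q) by ring]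
  field_simp

lemma poleTerm_mul {q : ℂ} (hq : q ≠ 0) (y : ℂ) (i : ℤ) :
    poleTerm q (q * y) i = poleTerm q y (i + 1) := by
  rw [poleTerm, poleTerm, zpow_neg, zpow_neg, ← mul_inv, ← mul_inv, zpow_add_one₀ hq]
  ring_nf

lemma thetaCoeff_mul_zpow {q y : ℂ} (hq : q ≠ 0) (hy : y ≠ 0) (k : ℤ) :
    thetaCoeff q k * (q * y) ^ k = -y⁻¹ * (thetaCoeff q (k + 1) * y ^ (k + 1)) := by
  rw [thetaCoeff_succ hq, mul_zpow, zpow_add_one₀ hy]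
  field_simp

lemma tsum_theta_mul {q y : ℂ} (hq : q ≠ 0) (hy : y ≠ 0) :
    ∑' k : ℤ, thetaCoeff q k * (q * y) ^ k = -y⁻¹ * ∑' k : ℤ, thetaCoeff q k * y ^ k := by
  rw [← (Equiv.addRight (1 : ℤ)).tsum_eq (fun k => thetaCoeff q k * y ^ k), ← tsum_mul_left]
  exact tsum_congr fun k => thetaCoeff_mul_zpow hq hy k

lemma tsum_appellTerm_mul {q y : ℂ} (hq : q ≠ 0) (hy : y ≠ 0) :
    ∑' l : ℤ, appellTerm q (q * y) l = -(y * q)⁻¹ * ∑' l : ℤ, appellTerm q y l := by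
  rw [← (Equiv.addRight (1 : ℤ)).tsum_eq (appellTerm q y), ← tsum_mul_left]
  exact tsum_congr fun l => appellTerm_mul hq hy l

lemma tsum_poleTerm_mul {q : ℂ} (hq : q ≠ 0) (y : ℂ) :
    ∑' i : ℤ, poleTerm q (q * y) i = ∑' i : ℤ, poleTerm q y i := by
  rw [← (Equiv.addRight (1 : ℤ)).tsum_eq (poleTerm q y)]
  exact tsum_congr fun i => poleTerm_mul hq y i

lemma summable_appellTerm_mul_iff {q y : ℂ} (hq : q ≠ 0) (hy : y ≠ 0) :
    Summable (appellTerm q (q * y)) ↔ Summable (appellTerm q y) := by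
  rw [← (Equiv.addRight (1 : ℤ)).summable_iff (f := appellTerm q y),
    funext fun l => appellTerm_mul hq hy l]
  exact summable_mul_left_iff (by simp [hq, hy])

lemma summable_poleTerm_mul_iff {q : ℂ} (hq : q ≠ 0) (y : ℂ) :
    Summable (poleTerm q (q * y)) ↔ Summable (poleTerm q y) := by
  rw [← (Equiv.addRight (1 : ℤ)).summable_iff (f := poleTerm q y),
    funext fun i => poleTerm_mul hq y i]
  rfl

/-- A property invariant under `y ↦ q y` holds off `q^ℤ` once it holds on the fundamental annulus
`‖q‖ < ‖y‖ ≤ 1` away from `1`. -/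
lemma forall_of_fundamental_annulus {q : ℂ} (hq : q ≠ 0) (h1 : ‖q‖ < 1) {P : ℂ → Prop}
    (hP : ∀ y, y ≠ 0 → (P (q * y) ↔ P y))
    (h : ∀ y, ‖q‖ < ‖y‖ → ‖y‖ ≤ 1 → y ≠ 1 → P y) {y : ℂ} (hy : y ≠ 0)
    (hyq : ∀ k : ℤ, y * q ^ k ≠ 1) : P y := by
  have key : ∀ k : ℤ, P (q ^ k * y) ↔ P y := by
    intro k
    induction k using Int.induction_on with
    | zero => simp
    | succ n ih =>
      rw [← ih, zpow_add_one₀ hq, mul_comm _ q, mul_assoc]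
      exact hP _ (mul_ne_zero (zpow_ne_zero _ hq) hy)
    | pred n ih =>
      rw [← ih, ← hP _ (mul_ne_zero (zpow_ne_zero _ hq) hy), ← mul_assoc, ← zpow_one_add₀ hq]
      ring_nf
  have hq0 : 0 < ‖q‖ := norm_pos_iff.2 hq
  -- Here ‖q‖^{−n} < ‖y‖ ≤ ‖q‖^{−(n+1)}, so q^{n+1} y lies in the fundamental annulus.
  obtain ⟨n, hn1, hn2⟩ := exists_mem_Ioc_zpow (norm_pos_iff.2 hy) (one_lt_inv₀ hq0 |>.2 h1)
  have hz : 0 < ‖q‖ ^ n := zpow_pos hq0 _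
  refine (key (n + 1)).1 (h _ ?_ ?_ ?_)
  · rw [norm_mul, norm_zpow, zpow_add_one₀ hq0.ne']
    rw [inv_zpow, inv_lt_iff_one_lt_mul₀ hz] at hn1
    nlinarith
  · rw [norm_mul, norm_zpow]
    rw [inv_zpow] at hn2
    have hz' : 0 < ‖q‖ ^ (n + 1) := zpow_pos hq0 _
    rwa [le_inv_comm₀ (norm_pos_iff.2 hy) hz', le_inv_comm₀ hz' (norm_pos_iff.2 hy),
      ← one_div, le_div_iff₀ hz', mul_comm] at hn2
  · rw [mul_comm]; exact hyq _

/-! ### Uniform bounds, continuity and absolute convergence -/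

/-- The part of the closed annulus `r ≤ ‖y‖ ≤ 1` at distance at least `δ` from `1`. -/
def slitAnnulus (r δ : ℝ) : Set ℂ := {y | r ≤ ‖y‖ ∧ ‖y‖ ≤ 1 ∧ δ ≤ ‖1 - y‖}

lemma one_sub_le_norm_one_sub {u : ℂ} {a : ℝ} (hu : ‖u‖ ≤ a) : 1 - a ≤ ‖1 - u‖ := by
  have := norm_sub_norm_le (1 : ℂ) u
  rw [norm_one] at this
  linarith

lemma norm_one_sub_le_norm_one_sub_inv {u : ℂ} (hu : u ≠ 0) (h1 : ‖u‖ ≤ 1) :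
    ‖1 - u‖ ≤ ‖1 - u⁻¹‖ := by
  rw [show 1 - u⁻¹ = -(1 - u) / u by field_simp; ring, norm_div, norm_neg]
  exact le_div_self (norm_nonneg _) (norm_pos_iff.2 hu) h1

/-- Only i = 0 can bring y q^i near 1, and δ controls that case. For i > 0 the point itself, and for
i < 0 its inverse, has norm at most ‖q‖ / r < 1. -/
lemma exists_le_norm_one_sub {q : ℂ} (hq : q ≠ 0) (h1 : ‖q‖ < 1) {r δ : ℝ} (hr : ‖q‖ < r)
    (hr1 : r ≤ 1) (hδ : 0 < δ) :
    ∃ c > 0, ∀ y ∈ slitAnnulus r δ, ∀ i : ℤ, c ≤ ‖1 - y * q ^ i‖ ∧ c ≤ ‖1 - (y * q ^ i)⁻¹‖ := by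
  have hq0 : 0 < ‖q‖ := norm_pos_iff.2 hq
  have hr0 : 0 < r := hq0.trans hr
  have ha : ‖q‖ / r < 1 := (div_lt_one hr0).2 hr
  have aux : ∀ u : ℂ, u ≠ 0 → ‖u‖ ≤ ‖q‖ / r →
      1 - ‖q‖ / r ≤ ‖1 - u‖ ∧ 1 - ‖q‖ / r ≤ ‖1 - u⁻¹‖ := fun u hu h =>
    ⟨one_sub_le_norm_one_sub h, (one_sub_le_norm_one_sub h).trans
      (norm_one_sub_le_norm_one_sub_inv hu (h.trans ha.le))⟩
  refine ⟨min δ (1 - ‖q‖ / r), lt_min hδ (by linarith), fun y ⟨hy1, hy2, hy3⟩ i => ?_⟩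
  have hy0 : 0 < ‖y‖ := hr0.trans_le hy1
  have hu : y * q ^ i ≠ 0 := mul_ne_zero (norm_pos_iff.1 hy0) (zpow_ne_zero _ hq)
  rcases lt_trichotomy i 0 with hi | rfl | hi
  · obtain ⟨n, rfl⟩ : ∃ n : ℕ, i = -(n + 1 : ℕ) := ⟨(-i - 1).toNat, by lia⟩
    have h := aux (y * q ^ (-(n + 1 : ℕ) : ℤ))⁻¹ (inv_ne_zero hu) (by
      rw [zpow_neg, zpow_natCast, mul_inv, inv_inv, norm_mul, norm_inv, norm_pow, pow_succ,
        div_eq_mul_inv, mul_comm]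
      have : ‖q‖ ^ n ≤ 1 := pow_le_one₀ hq0.le h1.le
      gcongr
      nlinarith)
    rw [inv_inv] at h
    exact ⟨(min_le_right _ _).trans h.2, (min_le_right _ _).trans h.1⟩
  · rw [zpow_zero, mul_one] at *
    exact ⟨(min_le_left _ _).trans hy3,
      (min_le_left _ _).trans (hy3.trans (norm_one_sub_le_norm_one_sub_inv hu hy2))⟩
  · obtain ⟨n, rfl⟩ : ∃ n : ℕ, i = (n + 1 : ℕ) := ⟨(i - 1).toNat, by lia⟩
    have h := aux (y * q ^ ((n + 1 : ℕ) : ℤ)) hu (by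
      rw [zpow_natCast, norm_mul, norm_pow, pow_succ]
      have : ‖q‖ ^ n ≤ 1 := pow_le_one₀ hq0.le h1.le
      have h2 : ‖q‖ ≤ ‖q‖ / r := le_div_self hq0.le hr0 hr1
      calc ‖y‖ * (‖q‖ ^ n * ‖q‖) ≤ 1 * (1 * ‖q‖) := by gcongr
        _ ≤ _ := by simpa using h2)
    exact ⟨(min_le_right _ _).trans h.1, (min_le_right _ _).trans h.2⟩

lemma zpow_le_one_add_zpow {r x : ℝ} (hr : 0 < r) (hrx : r ≤ x) (hx : x ≤ 1) (k : ℤ) :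
    x ^ k ≤ 1 + r ^ k := by
  have := zpow_pos hr k
  obtain ⟨n, rfl | rfl⟩ := k.eq_nat_or_neg
  · simp only [zpow_natCast] at *
    linarith [pow_le_one₀ (n := n) (hr.le.trans hrx) hx]
  · have h2 : x ^ (-(n : ℤ)) ≤ r ^ (-(n : ℤ)) := by
      rw [zpow_neg, zpow_neg, zpow_natCast, zpow_natCast]
      gcongr
    linarith

lemma exists_bound_appellTerm {q : ℂ} (hq : q ≠ 0) (h1 : ‖q‖ < 1) {r δ : ℝ} (hr : ‖q‖ < r)
    (hr1 : r ≤ 1) (hδ : 0 < δ) :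
    ∃ u : ℤ → ℝ, Summable u ∧ ∀ l, ∀ y ∈ slitAnnulus r δ, ‖appellTerm q y l‖ ≤ u l := by
  obtain ⟨c, hc, hcb⟩ := exists_le_norm_one_sub hq h1 hr hr1 hδ
  have hq0 : 0 < ‖q‖ := norm_pos_iff.2 hq
  have hr0 : 0 < r := hq0.trans hr
  refine ⟨fun l => (‖thetaCoeff q l‖ * ‖q‖ ^ l + ‖thetaCoeff q l‖ * (‖q‖ * r) ^ l) / c,
    ((summable_norm_thetaCoeff hq h1 hq0).add
      (summable_norm_thetaCoeff hq h1 (mul_pos hq0 hr0))).div_const c, fun l y hy => ?_⟩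
  have hb : ‖y‖ ^ l ≤ 1 + r ^ l := zpow_le_one_add_zpow hr0 hy.1 hy.2.1 l
  beta_reduce
  rw [appellTerm_eq hq, norm_div, norm_mul, norm_mul, norm_zpow, norm_zpow, mul_zpow, ← mul_assoc,
    ← mul_one_add]
  gcongr
  exact (hcb y hy l).1

lemma exists_bound_poleTerm {q : ℂ} (hq : q ≠ 0) (h1 : ‖q‖ < 1) {r δ : ℝ} (hr : ‖q‖ < r)
    (hr1 : r ≤ 1) (hδ : 0 < δ) :
    ∃ u : ℤ → ℝ, Summable u ∧ ∀ i, ∀ y ∈ slitAnnulus r δ, ‖poleTerm q y i‖ ≤ u i := by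
  obtain ⟨c, hc, hcb⟩ := exists_le_norm_one_sub hq h1 hr hr1 hδ
  have hq0 : 0 < ‖q‖ := norm_pos_iff.2 hq
  have hr0 : 0 < r := hq0.trans hr
  have hg := summable_geometric_of_lt_one hq0.le h1
  refine ⟨fun i => r⁻¹ * ‖q‖ ^ i.natAbs / c ^ 2, ?_, fun i y hy => ?_⟩
  · exact ((Summable.of_nat_of_neg (f := fun i : ℤ => ‖q‖ ^ i.natAbs) (by simpa using hg)
      (by simpa using hg)).mul_left _).div_const _
  have hy0 : 0 < ‖y‖ := hr0.trans_le hy.1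
  have hri : 1 ≤ r⁻¹ := (one_le_inv₀ hr0).2 hr1
  beta_reduce
  obtain ⟨n, rfl | rfl⟩ := i.eq_nat_or_neg
  · rw [poleTerm_eq hq (norm_pos_iff.1 hy0), norm_div, norm_neg, norm_pow]
    have h2 := (hcb y hy n).1
    gcongr
    rw [norm_mul, zpow_natCast, norm_pow, Int.natAbs_natCast]
    gcongr
    exact hy.2.1.trans hri
  · rw [poleTerm_eq_inv hq (norm_pos_iff.1 hy0), norm_div, norm_neg, norm_pow]
    have h2 := (hcb y hy (-n)).2
    gcongr
    rw [zpow_neg, mul_inv, inv_inv, norm_mul, norm_inv, zpow_natCast, norm_pow, Int.natAbs_neg,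
      Int.natAbs_natCast]
    gcongr
    exact hy.1

lemma ne_zero_of_mem_slitAnnulus {r δ : ℝ} (hr : 0 < r) {y : ℂ} (hy : y ∈ slitAnnulus r δ) :
    y ≠ 0 := norm_pos_iff.1 (hr.trans_le hy.1)

lemma continuousOn_tsum_appellTerm {q : ℂ} (hq : q ≠ 0) (h1 : ‖q‖ < 1) {r δ : ℝ} (hr : ‖q‖ < r)
    (hr1 : r ≤ 1) (hδ : 0 < δ) :
    ContinuousOn (fun y => ∑' l, appellTerm q y l) (slitAnnulus r δ) := by
  obtain ⟨u, hu, hb⟩ := exists_bound_appellTerm hq h1 hr hr1 hδ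
  obtain ⟨c, hc, hcb⟩ := exists_le_norm_one_sub hq h1 hr hr1 hδ
  refine continuousOn_tsum (fun l => ?_) hu hb
  have h0 : ∀ y ∈ slitAnnulus r δ, y ≠ 0 := fun y hy =>
    ne_zero_of_mem_slitAnnulus ((norm_nonneg q).trans_lt hr) hy
  refine ContinuousOn.div ?_ (by fun_prop) fun y hy =>
    norm_pos_iff.1 (hc.trans_le (hcb y hy l).1)
  exact (continuousOn_const.mul (continuousOn_id.zpow₀ l fun y hy => Or.inl (h0 y hy))).mul
    continuousOn_const

lemma continuousOn_tsum_poleTerm {q : ℂ} (hq : q ≠ 0) (h1 : ‖q‖ < 1) {r δ : ℝ} (hr : ‖q‖ < r)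
    (hr1 : r ≤ 1) (hδ : 0 < δ) :
    ContinuousOn (fun y => ∑' i, poleTerm q y i) (slitAnnulus r δ) := by
  obtain ⟨u, hu, hb⟩ := exists_bound_poleTerm hq h1 hr hr1 hδ
  obtain ⟨c, hc, hcb⟩ := exists_le_norm_one_sub hq h1 hr hr1 hδ
  refine continuousOn_tsum (fun i => ?_) hu hb
  have h0 : ∀ y ∈ slitAnnulus r δ, y ≠ 0 := fun y hy =>
    ne_zero_of_mem_slitAnnulus ((norm_nonneg q).trans_lt hr) hy
  have hi : ContinuousOn (fun y : ℂ => y⁻¹) (slitAnnulus r δ) := continuousOn_id.inv₀ h0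
  refine continuousOn_const.div (ContinuousOn.mul (by fun_prop) (by fun_prop)) fun y hy => ?_
  rw [zpow_neg, ← mul_inv]
  exact mul_ne_zero (norm_pos_iff.1 (hc.trans_le (hcb y hy i).1))
    (norm_pos_iff.1 (hc.trans_le (hcb y hy i).2))

lemma continuousOn_tsum_theta {q : ℂ} (hq : q ≠ 0) (h1 : ‖q‖ < 1) {r δ : ℝ} (hr : 0 < r) :
    ContinuousOn (fun y => ∑' k : ℤ, thetaCoeff q k * y ^ k) (slitAnnulus r δ) := by
  refine continuousOn_tsum (u := fun k => ‖thetaCoeff q k‖ * 1 ^ k + ‖thetaCoeff q k‖ * r ^ k)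
    (fun k => continuousOn_const.mul (continuousOn_id.zpow₀ k fun y hy =>
      Or.inl (ne_zero_of_mem_slitAnnulus hr hy)))
    ((summable_norm_thetaCoeff hq h1 one_pos).add (summable_norm_thetaCoeff hq h1 hr))
    fun k y hy => ?_
  rw [norm_mul, norm_zpow, one_zpow, ← mul_add]
  gcongr
  exact zpow_le_one_add_zpow hr hy.1 hy.2.1 k

lemma summable_appellTerm_of_annulus {q y : ℂ} (hq : q ≠ 0) (h1 : ‖q‖ < 1) (hy : ‖q‖ < ‖y‖)
    (hy1 : ‖y‖ ≤ 1) (hne : y ≠ 1) : Summable (appellTerm q y) := by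
  obtain ⟨u, hu, hb⟩ := exists_bound_appellTerm hq h1 hy hy1
    (norm_pos_iff.2 (sub_ne_zero.2 hne.symm))
  exact Summable.of_norm_bounded hu fun l => hb l y ⟨le_rfl, hy1, le_rfl⟩

lemma summable_poleTerm_of_annulus {q y : ℂ} (hq : q ≠ 0) (h1 : ‖q‖ < 1) (hy : ‖q‖ < ‖y‖)
    (hy1 : ‖y‖ ≤ 1) (hne : y ≠ 1) : Summable (poleTerm q y) := by
  obtain ⟨u, hu, hb⟩ := exists_bound_poleTerm hq h1 hy hy1
    (norm_pos_iff.2 (sub_ne_zero.2 hne.symm))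
  exact Summable.of_norm_bounded hu fun l => hb l y ⟨le_rfl, hy1, le_rfl⟩

theorem summable_appellTerm {q y : ℂ} (hq : q ≠ 0) (h1 : ‖q‖ < 1) (hy : y ≠ 0)
    (hyq : ∀ k : ℤ, y * q ^ k ≠ 1) : Summable (appellTerm q y) :=
  forall_of_fundamental_annulus hq h1 (P := fun y => Summable (appellTerm q y))
    (fun _ hy => summable_appellTerm_mul_iff hq hy)
    (fun _ => summable_appellTerm_of_annulus hq h1) hy hyq

theorem summable_poleTerm {q y : ℂ} (hq : q ≠ 0) (h1 : ‖q‖ < 1) (hy : y ≠ 0)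
    (hyq : ∀ k : ℤ, y * q ^ k ≠ 1) : Summable (poleTerm q y) :=
  forall_of_fundamental_annulus hq h1 (P := fun y => Summable (poleTerm q y))
    (fun y _ => summable_poleTerm_mul_iff hq y)
    (fun _ => summable_poleTerm_of_annulus hq h1) hy hyq

/-! ### Laurent expansions in the open annulus -/

lemma hasSum_tsum_swap {f : ℤ → ℤ → ℂ} {R : ℤ → ℂ} (hR : ∀ l, HasSum (f l) (R l))
    (hn : Summable fun l => ∑' n, ‖f l n‖) :
    HasSum (fun n => ∑' l, f l n) (∑' l, R l) := by
  have hs : Summable fun p : ℤ × ℤ => f p.1 p.2 :=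
    Summable.of_norm ((summable_prod_of_nonneg fun _ => norm_nonneg _).2
      ⟨fun l => (hR l).summable.norm, hn⟩)
  have h := hs.hasSum
  rw [hs.tsum_prod, tsum_congr fun l => (hR l).tsum_eq] at h
  have h' := (Equiv.prodComm ℤ ℤ).hasSum_iff.2 h
  exact h'.prod_fiberwise fun n => (h'.summable.prod_factor n).hasSum

/-- The orientation sign of `l` in the interval between `0` and `n`. -/
def intervalSign (l n : ℤ) : ℂ := if 0 ≤ l ∧ l < n then 1 else if n ≤ l ∧ l < 0 then -1 else 0

/-- The coefficient of `y^n` in the `l`-th term of `y` times the Appell–Lerch sum. -/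
def appellCoeff (q : ℂ) (l n : ℤ) : ℂ :=
  intervalSign l n * (thetaCoeff q l * q ^ l * q ^ (l * (n - 1 - l)))

/-- The coefficient of `y^n` in the expansion of `poleTerm q y i`. -/
def poleCoeff (q : ℂ) (i n : ℤ) : ℂ :=
  if 0 ≤ i ∧ 0 < n then -n * q ^ (i * n) else if i < 0 ∧ n < 0 then n * q ^ (i * n) else 0

lemma hasSum_geometric_add {u : ℂ} (hu : ‖u‖ < 1) (K : ℂ) :
    HasSum (fun a : ℕ => K * u ^ a) (K / (1 - u)) := by
  simpa [div_eq_mul_inv] using (hasSum_geometric_of_norm_lt_one hu).mul_left K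

lemma norm_mul_pow_lt_one {q y : ℂ} (h1 : ‖q‖ < 1) (hy1 : ‖y‖ < 1) (n : ℕ) :
    ‖y * q ^ (n : ℤ)‖ < 1 := by
  rw [norm_mul, zpow_natCast, norm_pow]
  exact mul_lt_one_of_nonneg_of_lt_one_left (norm_nonneg _) hy1 (pow_le_one₀ (norm_nonneg _) h1.le)

lemma norm_mul_zpow_inv_lt_one {q y : ℂ} (hq : q ≠ 0) (h1 : ‖q‖ < 1) (hy : ‖q‖ < ‖y‖) (n : ℕ) :
    ‖(y * q ^ (-(n : ℤ) - 1))⁻¹‖ < 1 := by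
  have hq0 : 0 < ‖q‖ := norm_pos_iff.2 hq
  rw [show -(n : ℤ) - 1 = -((n + 1 : ℕ) : ℤ) by push_cast; ring, zpow_neg, zpow_natCast, mul_inv,
    inv_inv, norm_mul, norm_inv, norm_pow, inv_mul_lt_one₀ (hq0.trans hy), pow_succ]
  have : ‖q‖ ^ n ≤ 1 := pow_le_one₀ hq0.le h1.le
  nlinarith

lemma hasSum_appellCoeff {q y : ℂ} (hq : q ≠ 0) (h1 : ‖q‖ < 1) (hy : ‖q‖ < ‖y‖) (hy1 : ‖y‖ < 1)
    (l : ℤ) : HasSum (fun n : ℤ => appellCoeff q l n * y ^ n) (y * appellTerm q y l) := by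
  have hy0 : y ≠ 0 := norm_pos_iff.1 ((norm_nonneg q).trans_lt hy)
  have hterm : ∀ n : ℤ, thetaCoeff q l * q ^ l * q ^ (l * (n - 1 - l)) * y ^ n =
      thetaCoeff q l * q ^ l * y ^ (l + 1) * (y * q ^ l) ^ (n - 1 - l) := fun n => by
    rw [mul_zpow, ← zpow_mul, show y ^ n = y ^ (l + 1) * y ^ (n - 1 - l) by
      rw [← zpow_add₀ hy0]; ring_nf]
    ring
  rw [appellTerm_eq hq]
  rcases lt_or_ge l 0 with hl | hl
  · obtain ⟨m, rfl⟩ : ∃ m : ℕ, l = -(m : ℤ) - 1 := ⟨(-l - 1).toNat, by lia⟩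
    set l : ℤ := -(m : ℤ) - 1 with hl'
    have hu := norm_mul_zpow_inv_lt_one hq h1 hy m
    have hu0 : y * q ^ l ≠ 0 := mul_ne_zero hy0 (zpow_ne_zero _ hq)
    have hinj : Function.Injective fun a : ℕ => l - (a : ℤ) := fun a b h => by simpa using h
    rw [← hinj.hasSum_iff]
    · refine (hasSum_geometric_add hu
        (-(thetaCoeff q l * q ^ l * y ^ (l + 1)) * (y * q ^ l)⁻¹)).of_eq (fun a => ?_) ?_
      · rw [Function.comp, appellCoeff, intervalSign, if_neg (by lia), if_pos (by lia), mul_assoc,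
          hterm, show l - (a : ℤ) - 1 - l = -((a + 1 : ℕ) : ℤ) by push_cast; ring, zpow_neg,
          zpow_natCast, pow_succ, inv_pow]
        rw [mul_inv]; ring
      · have hne : 1 - y * q ^ l ≠ 0 := fun h => by
          rw [← hl', ← sub_eq_zero.1 h] at hu
          simp at hu
        rw [show 1 - (y * q ^ l)⁻¹ = -(1 - y * q ^ l) / (y * q ^ l) by field_simp; ring,
          zpow_add_one₀ hy0]
        field_simp
    · intro n hn
      have : ¬ n ≤ l := fun h => hn ⟨(l - n).toNat, by simp only; lia⟩
      rw [appellCoeff, intervalSign, if_neg (by lia), if_neg (by lia)]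
      simp
  · obtain ⟨m, rfl⟩ := Int.eq_ofNat_of_zero_le hl
    have hu := norm_mul_pow_lt_one h1 hy1 m
    have hinj : Function.Injective fun a : ℕ => (m : ℤ) + 1 + (a : ℤ) := fun a b h => by
      simpa using h
    rw [← hinj.hasSum_iff]
    · refine (hasSum_geometric_add hu
        (thetaCoeff q m * q ^ (m : ℤ) * y ^ ((m : ℤ) + 1))).of_eq (fun a => ?_) ?_
      · rw [Function.comp, appellCoeff, intervalSign, if_pos (by lia), mul_assoc,
          hterm, show (m : ℤ) + 1 + a - 1 - m = (a : ℤ) by ring, zpow_natCast (y * q ^ (m : ℤ)) a]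
        ring
      · rw [zpow_add_one₀ hy0]
        ring
    · intro n hn
      have : ¬ (m : ℤ) < n := fun h => hn ⟨(n - m - 1).toNat, by simp only; lia⟩
      rw [appellCoeff, intervalSign, if_neg (by lia), if_neg (by lia)]
      simp

lemma hasSum_poleCoeff {q y : ℂ} (hq : q ≠ 0) (h1 : ‖q‖ < 1) (hy : ‖q‖ < ‖y‖) (hy1 : ‖y‖ < 1)
    (i : ℤ) : HasSum (fun n : ℤ => poleCoeff q i n * y ^ n) (poleTerm q y i) := by
  have hy0 : y ≠ 0 := norm_pos_iff.1 ((norm_nonneg q).trans_lt hy)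
  have hterm : ∀ n : ℤ, q ^ (i * n) * y ^ n = (y * q ^ i) ^ n := fun n => by
    rw [mul_zpow, ← zpow_mul, mul_comm]
  rcases lt_or_ge i 0 with hi | hi
  · obtain ⟨m, rfl⟩ : ∃ m : ℕ, i = -(m : ℤ) - 1 := ⟨(-i - 1).toNat, by lia⟩
    have hu := norm_mul_zpow_inv_lt_one hq h1 hy m
    have hinj : Function.Injective fun a : ℕ => -(a : ℤ) := fun a b h => by simpa using h
    rw [← hinj.hasSum_iff]
    · refine (hasSum_coe_mul_geometric_of_norm_lt_one hu).neg.of_eq (fun a => ?_) ?_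
      · rw [Function.comp, poleCoeff, if_neg (by lia)]
        rcases a.eq_zero_or_pos with rfl | ha
        · simp
        · rw [if_pos (by lia), mul_assoc, hterm, zpow_neg, zpow_natCast, inv_pow]
          push_cast
          ring
      · rw [poleTerm_eq_inv hq hy0, neg_div]
    · intro n hn
      have : ¬ n < 0 := fun h => hn ⟨(-n).toNat, by simp only; lia⟩
      rw [poleCoeff, if_neg (by lia), if_neg (by lia), zero_mul]
  · obtain ⟨m, rfl⟩ := Int.eq_ofNat_of_zero_le hi
    have hu := norm_mul_pow_lt_one h1 hy1 m
    have hinj : Function.Injective fun a : ℕ => (a : ℤ) := Nat.cast_injective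
    rw [← hinj.hasSum_iff]
    · refine (hasSum_coe_mul_geometric_of_norm_lt_one hu).neg.of_eq (fun a => ?_) ?_
      · rw [Function.comp, poleCoeff]
        rcases a.eq_zero_or_pos with rfl | ha
        · simp
        · rw [if_pos (by lia), mul_assoc, hterm, zpow_natCast (y * q ^ (m : ℤ)) a]
          push_cast
          ring
      · rw [poleTerm_eq hq hy0, neg_div]
    · intro n hn
      have : ¬ 0 < n := fun h => hn ⟨n.toNat, by simp only; lia⟩
      rw [poleCoeff, if_neg (by lia), if_neg (by lia), zero_mul]

/-- At the real point (‖q‖, ‖y‖) the sign of each coefficient depends on l alone. The inner sums of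
absolute values are therefore, up to sign, the terms of the same series at that point, whose
convergence is already known; this supplies the Fubini hypothesis. -/
lemma appellCoeff_norm (q y : ℂ) (l n : ℤ) :
    appellCoeff (‖q‖ : ℂ) l n * (‖y‖ : ℂ) ^ n =
      (-1) ^ l * (if 0 ≤ l then 1 else -1) * (‖appellCoeff q l n * y ^ n‖ : ℂ) := by
  have hs : intervalSign l n = (if 0 ≤ l then 1 else -1) * (‖intervalSign l n‖ : ℂ) := by
    simp only [intervalSign]
    split_ifs <;> first | (exfalso; lia) | simp
  have ht : (‖thetaCoeff q l‖ : ℂ) = (‖q‖ : ℂ) ^ (l * (l - 1) / 2) := by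
    simp [thetaCoeff]
  simp only [norm_mul, Complex.ofReal_mul, appellCoeff, ht]
  rw [hs, thetaCoeff]
  simp only [norm_zpow, Complex.ofReal_zpow, norm_mul, Complex.ofReal_mul, norm_norm,
    Complex.norm_real]
  split_ifs <;> simp <;> ring

lemma poleCoeff_norm (q y : ℂ) (i n : ℤ) :
    poleCoeff (‖q‖ : ℂ) i n * (‖y‖ : ℂ) ^ n = -(‖poleCoeff q i n * y ^ n‖ : ℂ) := by
  rw [poleCoeff, poleCoeff]
  split_ifs with h h
  · have : |(n : ℝ)| = n := abs_of_pos (by exact_mod_cast h.2)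
    simp [Complex.norm_intCast, this]
  · have : |(n : ℝ)| = -n := abs_of_neg (by exact_mod_cast h.2)
    simp [Complex.norm_intCast, this]
  · simp

lemma norm_coe_ne_one {y : ℂ} (hy1 : ‖y‖ < 1) : (‖y‖ : ℂ) ≠ 1 := by
  exact_mod_cast hy1.ne

lemma summable_tsum_norm_appellCoeff {q y : ℂ} (hq : q ≠ 0) (h1 : ‖q‖ < 1) (hy : ‖q‖ < ‖y‖)
    (hy1 : ‖y‖ < 1) : Summable fun l : ℤ => ∑' n : ℤ, ‖appellCoeff q l n * y ^ n‖ := by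
  have hQ : (‖q‖ : ℂ) ≠ 0 := by simpa using hq
  have hs := (summable_appellTerm_of_annulus (q := ‖q‖) (y := ‖y‖) hQ (by simpa) (by simpa)
    (by simpa using hy1.le) (norm_coe_ne_one hy1)).norm.mul_left ‖y‖
  refine hs.congr fun l => ?_
  have h := hasSum_appellCoeff (q := ‖q‖) (y := ‖y‖) hQ (by simpa) (by simpa) (by simpa) l
  simp only [appellCoeff_norm] at h
  have h2 := congrArg norm h.tsum_eq
  rw [tsum_mul_left, ← Complex.ofReal_tsum, norm_mul, norm_mul, norm_mul, Complex.norm_real,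
    Complex.norm_real, norm_norm,
    Real.norm_of_nonneg (tsum_nonneg fun _ => norm_nonneg _)] at h2
  rw [← h2]
  split_ifs <;> simp

lemma summable_tsum_norm_poleCoeff {q y : ℂ} (hq : q ≠ 0) (h1 : ‖q‖ < 1) (hy : ‖q‖ < ‖y‖)
    (hy1 : ‖y‖ < 1) : Summable fun i : ℤ => ∑' n : ℤ, ‖poleCoeff q i n * y ^ n‖ := by
  have hQ : (‖q‖ : ℂ) ≠ 0 := by simpa using hq
  have hs := (summable_poleTerm_of_annulus (q := ‖q‖) (y := ‖y‖) hQ (by simpa) (by simpa)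
    (by simpa using hy1.le) (norm_coe_ne_one hy1)).norm
  refine hs.congr fun i => ?_
  have h := hasSum_poleCoeff (q := ‖q‖) (y := ‖y‖) hQ (by simpa) (by simpa) (by simpa) i
  simp only [poleCoeff_norm] at h
  have h2 := congrArg norm h.tsum_eq
  rw [tsum_neg, ← Complex.ofReal_tsum, norm_neg, Complex.norm_real,
    Real.norm_of_nonneg (tsum_nonneg fun _ => norm_nonneg _)] at h2
  exact h2.symm

lemma one_sub_zpow_ne_zero {q : ℂ} (h1 : ‖q‖ < 1) {n : ℤ} (hn : n ≠ 0) : 1 - q ^ n ≠ 0 := by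
  obtain ⟨m, rfl | rfl⟩ := n.eq_nat_or_neg
  · obtain ⟨k, rfl⟩ : ∃ k, m = k + 1 := ⟨m - 1, by lia⟩
    exact_mod_cast norm_lt_one_pow_ne_one h1 k
  · obtain ⟨k, rfl⟩ : ∃ k, m = k + 1 := ⟨m - 1, by lia⟩
    intro h
    refine norm_lt_one_pow_ne_one h1 k ?_
    rw [zpow_neg, zpow_natCast, sub_eq_zero, eq_comm, inv_eq_one] at h
    rw [h, sub_self]

lemma hasSum_poleCoeff_left {q : ℂ} (hq : q ≠ 0) (h1 : ‖q‖ < 1) (n : ℤ) :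
    HasSum (fun i => poleCoeff q i n) (-n / (1 - q ^ n)) := by
  rcases lt_trichotomy n 0 with hn | rfl | hn
  · obtain ⟨m, rfl⟩ : ∃ m : ℕ, n = -((m + 1 : ℕ) : ℤ) := ⟨(-n - 1).toNat, by lia⟩
    have hu : ‖q ^ (m + 1)‖ < 1 := by
      rw [norm_pow]; exact pow_lt_one₀ (norm_nonneg _) h1 (by simp)
    have hne := norm_lt_one_pow_ne_one h1 m
    have hinj : Function.Injective fun a : ℕ => -(a : ℤ) - 1 := fun a b h => by simpa using h
    rw [← hinj.hasSum_iff]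
    · refine (hasSum_geometric_add hu (((-((m + 1 : ℕ) : ℤ) : ℤ) : ℂ) * q ^ (m + 1))).of_eq
        (fun a => ?_) ?_
      · rw [Function.comp, poleCoeff, if_neg (by lia), if_pos (by lia),
          show (-(a : ℤ) - 1) * -((m + 1 : ℕ) : ℤ) = (((m + 1) * (a + 1) : ℕ) : ℤ) by
            push_cast; ring, zpow_natCast, pow_mul, pow_succ]
        ring
      · have h2 : q ^ (m + 1) ≠ 0 := pow_ne_zero _ hq
        rw [zpow_neg, zpow_natCast, show 1 - (q ^ (m + 1))⁻¹ = -(1 - q ^ (m + 1)) / q ^ (m + 1) by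
          rw [eq_div_iff h2, sub_mul, inv_mul_cancel₀ h2]; ring]
        rw [div_div_eq_mul_div, neg_mul, neg_div_neg_eq]
    · intro i hi
      have : ¬ i < 0 := fun h => hi ⟨(-i - 1).toNat, by simp only; lia⟩
      rw [poleCoeff, if_neg (by lia), if_neg (by lia)]
  · simp [poleCoeff]
  · obtain ⟨m, rfl⟩ : ∃ m : ℕ, n = ((m + 1 : ℕ) : ℤ) := ⟨(n - 1).toNat, by lia⟩
    have hu : ‖q ^ (m + 1)‖ < 1 := by
      rw [norm_pow]; exact pow_lt_one₀ (norm_nonneg _) h1 (by simp)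
    have hinj : Function.Injective fun a : ℕ => (a : ℤ) := Nat.cast_injective
    rw [← hinj.hasSum_iff]
    · refine (hasSum_geometric_add hu _).of_eq (fun a => ?_) (by rw [zpow_natCast])
      rw [Function.comp, poleCoeff, if_pos (by lia),
        show (a : ℤ) * ((m + 1 : ℕ) : ℤ) = (((m + 1) * a : ℕ) : ℤ) by push_cast; ring,
        zpow_natCast, pow_mul]
    · intro i hi
      have : ¬ 0 ≤ i := fun h => hi ⟨i.toNat, by simp only; lia⟩
      rw [poleCoeff, if_neg (by lia), if_neg (by lia)]

/-- Laurent expansion of the Appell–Lerch sum in the annulus `‖q‖ < ‖y‖ < 1`. -/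
lemma hasSum_tsum_appellCoeff {q y : ℂ} (hq : q ≠ 0) (h1 : ‖q‖ < 1) (hy : ‖q‖ < ‖y‖)
    (hy1 : ‖y‖ < 1) :
    HasSum (fun n : ℤ => (∑' l, appellCoeff q l n) * y ^ n) (y * ∑' l, appellTerm q y l) := by
  have h := hasSum_tsum_swap (hasSum_appellCoeff hq h1 hy hy1)
    (summable_tsum_norm_appellCoeff hq h1 hy hy1)
  simpa only [tsum_mul_right, tsum_mul_left] using h

/-- Laurent expansion of the elliptic double-pole sum in the annulus `‖q‖ < ‖y‖ < 1`. -/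
lemma hasSum_laurent_poleTerm {q y : ℂ} (hq : q ≠ 0) (h1 : ‖q‖ < 1) (hy : ‖q‖ < ‖y‖)
    (hy1 : ‖y‖ < 1) :
    HasSum (fun n : ℤ => -n / (1 - q ^ n) * y ^ n) (∑' i, poleTerm q y i) := by
  have h := hasSum_tsum_swap (hasSum_poleCoeff hq h1 hy hy1)
    (summable_tsum_norm_poleCoeff hq h1 hy hy1)
  simpa only [tsum_mul_right, (hasSum_poleCoeff_left hq h1 _).tsum_eq] using h

/-! ### First-order recurrences for the Laurent coefficients -/

lemma intervalSign_sub (l n : ℤ) :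
    intervalSign l n - intervalSign (l - 1) (n - 1) = if l = 0 then 1 else 0 := by
  simp only [intervalSign]
  split_ifs <;> first | lia | norm_num

/-- Shifting (l, n) to (l − 1, n − 1) reproduces the monomial up to −q^{n−1}, while the shifted
interval differs only at l = 0. Summed over l, the relation collapses to 1. -/
lemma appellCoeff_add {q : ℂ} (hq : q ≠ 0) (l n : ℤ) :
    appellCoeff q l n + q ^ (n - 1) * appellCoeff q (l - 1) (n - 1) =
      if l = 0 then 1 else 0 := by
  have h : q ^ (n - 1) * (thetaCoeff q (l - 1) * q ^ (l - 1) * q ^ ((l - 1) * (n - 1 - 1 - (l - 1))))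
      = -(thetaCoeff q l * q ^ l * q ^ (l * (n - 1 - l))) := by
    rw [thetaCoeff_pred hq l, show l * (n - 1 - l) = (l - 1) * (n - 1 - 1 - (l - 1)) + (n - 1) - l by
      ring, zpow_sub₀ hq _ l, zpow_add₀ hq]
    have := zpow_ne_zero l hq
    field_simp
  have h2 : appellCoeff q l n + q ^ (n - 1) * appellCoeff q (l - 1) (n - 1) =
      (intervalSign l n - intervalSign (l - 1) (n - 1)) *
        (thetaCoeff q l * q ^ l * q ^ (l * (n - 1 - l))) := by
    rw [appellCoeff, appellCoeff]
    linear_combination intervalSign (l - 1) (n - 1) * h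
  rw [h2, intervalSign_sub]
  split_ifs with hl
  · simp [hl, thetaCoeff_zero]
  · simp

lemma summable_appellCoeff (q : ℂ) (n : ℤ) : Summable fun l => appellCoeff q l n := by
  refine summable_of_ne_finset_zero (s := Finset.Icc (min n 0) (max n 0)) fun l hl => ?_
  rw [Finset.mem_Icc] at hl
  rw [appellCoeff, intervalSign, if_neg (by lia), if_neg (by lia), zero_mul]

lemma tsum_appellCoeff_zero (q : ℂ) : ∑' l, appellCoeff q l 0 = 0 := by
  refine (tsum_congr fun l => ?_).trans tsum_zero
  rw [appellCoeff, intervalSign, if_neg (by lia), if_neg (by lia), zero_mul]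

lemma tsum_appellCoeff_add {q : ℂ} (hq : q ≠ 0) (n : ℤ) :
    ∑' l, appellCoeff q l n + q ^ (n - 1) * ∑' l, appellCoeff q l (n - 1) = 1 := by
  have h2 := (Equiv.subRight (1 : ℤ)).hasSum_iff.2 (summable_appellCoeff q (n - 1)).hasSum
  refine ((summable_appellCoeff q n).hasSum.add (h2.mul_left (q ^ (n - 1)))).unique ?_
  exact (hasSum_ite_eq (0 : ℤ) (1 : ℂ)).of_eq (fun l => appellCoeff_add hq l n) rfl

/-- The coefficient of `y^n` in the product of the theta series and the double-pole sum. -/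
def convCoeff (q : ℂ) (n : ℤ) : ℂ := ∑' m : ℤ, thetaCoeff q (n - m) * (-m / (1 - q ^ m))

/-- The shear `(n, m) ↦ (n - m, m)` of `ℤ × ℤ`. -/
def shear : ℤ × ℤ ≃ ℤ × ℤ where
  toFun p := (p.1 - p.2, p.2)
  invFun p := (p.1 + p.2, p.2)
  left_inv p := by simp
  right_inv p := by simp

/-- The Cauchy product of two absolutely convergent Laurent series. -/
lemma hasSum_laurent_mul {f g : ℤ → ℂ} {y : ℂ} (hy : y ≠ 0) (hf : Summable fun k => ‖f k * y ^ k‖)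
    (hg : Summable fun m => ‖g m * y ^ m‖) :
    (∀ n, Summable fun m => f (n - m) * g m) ∧
      HasSum (fun n => (∑' m, f (n - m) * g m) * y ^ n)
        ((∑' k, f k * y ^ k) * ∑' m, g m * y ^ m) := by
  have hp : Summable fun p : ℤ × ℤ => (f p.1 * y ^ p.1) * (g p.2 * y ^ p.2) :=
    summable_mul_of_summable_norm (f := fun k => f k * y ^ k) (g := fun m => g m * y ^ m) hf hg
  have h0 := HasSum.mul (f := fun k => f k * y ^ k) (g := fun m => g m * y ^ m)
    hf.of_norm.hasSum hg.of_norm.hasSum hp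
  have h : HasSum (fun p : ℤ × ℤ => f (p.1 - p.2) * g p.2 * y ^ p.1)
      ((∑' k, f k * y ^ k) * ∑' m, g m * y ^ m) := by
    refine (shear.hasSum_iff.2 h0).of_eq (fun p => ?_) rfl
    simp only [Function.comp, shear, Equiv.coe_fn_mk]
    rw [show y ^ p.1 = y ^ (p.1 - p.2) * y ^ p.2 by rw [← zpow_add₀ hy]; ring_nf]
    ring
  have hs : ∀ n : ℤ, Summable fun m => f (n - m) * g m := fun n =>
    (summable_mul_right_iff (zpow_ne_zero n hy)).1 (h.summable.prod_factor n)
  exact ⟨hs, h.prod_fiberwise fun n => (hs n).hasSum.mul_right (y ^ n)⟩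

lemma hasSum_theta_mul_poleTerm {q y : ℂ} (hq : q ≠ 0) (h1 : ‖q‖ < 1) (hy : ‖q‖ < ‖y‖)
    (hy1 : ‖y‖ < 1) :
    (∀ n : ℤ, Summable fun m : ℤ => thetaCoeff q (n - m) * (-m / (1 - q ^ m))) ∧
    HasSum (fun n : ℤ => convCoeff q n * y ^ n)
      ((∑' k : ℤ, thetaCoeff q k * y ^ k) * ∑' i, poleTerm q y i) := by
  have hS := hasSum_laurent_poleTerm hq h1 hy hy1
  rw [← hS.tsum_eq]
  exact hasSum_laurent_mul (norm_pos_iff.1 ((norm_nonneg q).trans_lt hy))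
    (summable_norm_theta hq h1 (norm_pos_iff.1 ((norm_nonneg q).trans_lt hy))) hS.summable.norm

/-- The series does not involve y, so a single point of the annulus suffices; a real r between ‖q‖
and 1 is used. -/
lemma summable_convCoeff {q : ℂ} (hq : q ≠ 0) (h1 : ‖q‖ < 1) (n : ℤ) :
    Summable fun m : ℤ => thetaCoeff q (n - m) * (-m / (1 - q ^ m)) := by
  obtain ⟨r, hr, hr1⟩ := exists_between h1
  have hr0 : 0 ≤ r := (norm_nonneg q).trans hr.le
  have hn : ‖(r : ℂ)‖ = r := by rw [Complex.norm_real, Real.norm_of_nonneg hr0]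
  exact (hasSum_theta_mul_poleTerm (y := r) hq h1 (by rwa [hn]) (by rwa [hn])).1 n

/-- The theta recurrence produces a factor 1 − q^m that cancels the denominator, leaving ∑ −m
`thetaCoeff q (n - m)`. With k = n − m this is ∑ k `thetaCoeff q k` − n ∑ `thetaCoeff q k`, and the
last sum is 0. -/
lemma convCoeff_add {q : ℂ} (hq : q ≠ 0) (h1 : ‖q‖ < 1) (n : ℤ) :
    convCoeff q n + q ^ (n - 1) * convCoeff q (n - 1) = -eulerProd q ^ 3 := by
  have hk := (summable_norm_mul_thetaCoeff hq h1).of_norm.hasSum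
  rw [tsum_mul_thetaCoeff hq h1] at hk
  have ht : HasSum (thetaCoeff q) 0 := by
    rw [← tsum_thetaCoeff hq h1]
    simpa using (summable_norm_theta hq h1 one_ne_zero).of_norm.hasSum
  have h := (Equiv.subLeft n).hasSum_iff.2 (hk.sub (ht.mul_left (n : ℂ)))
  refine ((summable_convCoeff hq h1 n).hasSum.add
    ((summable_convCoeff hq h1 (n - 1)).hasSum.mul_left (q ^ (n - 1)))).unique
    (h.of_eq (fun m => ?_) (by simp))
  have h2 : q ^ (n - 1) * thetaCoeff q (n - 1 - m) = -q ^ m * thetaCoeff q (n - m) := by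
    rw [thetaCoeff_pred hq (n - m), show n - 1 - m = n - m - 1 by ring,
      show n - 1 = m + (n - m - 1) by ring, zpow_add₀ hq]
    ring
  simp only [Function.comp, Equiv.subLeft_apply]
  rw [← mul_assoc, h2]
  -- At m = 0 the denominator vanishes, but the numerator −m makes the term 0 on both sides.
  rcases eq_or_ne m 0 with rfl | hm
  · simp
  · have := one_sub_zpow_ne_zero h1 hm
    push_cast
    field_simp
    ring

lemma convCoeff_sub {q : ℂ} (hq : q ≠ 0) (h1 : ‖q‖ < 1) (n : ℤ) :
    convCoeff q n - convCoeff q 0 * thetaCoeff q n =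
      -eulerProd q ^ 3 * ∑' l, appellCoeff q l n := by
  induction n using Int.induction_on with
  | zero => simp [thetaCoeff_zero, tsum_appellCoeff_zero]
  | succ n ih =>
    have e1 := convCoeff_add hq h1 (n + 1)
    have e2 := tsum_appellCoeff_add hq (n + 1)
    have e3 := thetaCoeff_succ hq n
    rw [add_sub_cancel_right] at e1 e2
    linear_combination e1 - convCoeff q 0 * e3 + eulerProd q ^ 3 * e2 - q ^ (n : ℤ) * ih
  | pred n ih =>
    have e1 := convCoeff_add hq h1 (-n)
    have e2 := tsum_appellCoeff_add hq (-n)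
    have e3 := thetaCoeff_pred hq (-n)
    refine mul_left_cancel₀ (zpow_ne_zero (-(n : ℤ) - 1) hq) ?_
    linear_combination e1 - convCoeff q 0 * e3 + eulerProd q ^ 3 * e2 - ih

/-! ### The identity, from the open annulus to all admissible y -/

/-- The identity between the theta series, the double-pole sum and the Appell–Lerch sum at `y`. -/
def AppellIdentity (q y : ℂ) : Prop :=
  (∑' k : ℤ, thetaCoeff q k * y ^ k) * (∑' i, poleTerm q y i - convCoeff q 0) =
    -eulerProd q ^ 3 * (y * ∑' l, appellTerm q y l)

lemma appellIdentity_of_open_annulus {q y : ℂ} (hq : q ≠ 0) (h1 : ‖q‖ < 1) (hy : ‖q‖ < ‖y‖)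
    (hy1 : ‖y‖ < 1) : AppellIdentity q y := by
  have hy0 : y ≠ 0 := norm_pos_iff.1 ((norm_nonneg q).trans_lt hy)
  have h2 := (hasSum_theta_mul_poleTerm hq h1 hy hy1).2
  have h3 := (summable_norm_theta hq h1 hy0).of_norm.hasSum.mul_left (convCoeff q 0)
  have h4 := ((hasSum_tsum_appellCoeff hq h1 hy hy1).mul_left (-eulerProd q ^ 3)).of_eq
    (g := fun n => convCoeff q n * y ^ n - convCoeff q 0 * (thetaCoeff q n * y ^ n))
    (fun n => by linear_combination y ^ n * convCoeff_sub hq h1 n) rfl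
  rw [AppellIdentity, h4.unique (h2.sub h3)]
  ring

lemma appellIdentity_of_annulus {q y : ℂ} (hq : q ≠ 0) (h1 : ‖q‖ < 1) (hy : ‖q‖ < ‖y‖)
    (hy1 : ‖y‖ ≤ 1) (hne : y ≠ 1) : AppellIdentity q y := by
  rcases hy1.lt_or_eq with hlt | heq
  · exact appellIdentity_of_open_annulus hq h1 hy hlt
  obtain ⟨r, hr, hr1⟩ := exists_between h1
  have hr0 : 0 < r := (norm_nonneg q).trans_lt hr
  have hd : 0 < ‖1 - y‖ := norm_pos_iff.2 (sub_ne_zero.2 hne.symm)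
  -- Half the distance to 1 leaves room for the points t y with t < 1 near 1 to stay in the slit
  -- annulus, where both sides are continuous.
  set δ := ‖1 - y‖ / 2 with hδ
  have hδ0 : 0 < δ := half_pos hd
  have hmem : y ∈ slitAnnulus r δ := ⟨by linarith, hy1, by linarith⟩
  have hcl := (continuousOn_tsum_theta (δ := δ) hq h1 hr0).mul
    ((continuousOn_tsum_poleTerm hq h1 hr hr1.le hδ0).sub
      (continuousOn_const (c := convCoeff q 0)))
  have hcr := (continuousOn_const (c := -eulerProd q ^ 3)).mul
    (continuousOn_id.mul (continuousOn_tsum_appellTerm hq h1 hr hr1.le hδ0))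
  have hc : Tendsto (fun t : ℝ => (t : ℂ) * y) (𝓝[<] 1) (𝓝 y) := by
    have : Tendsto (fun t : ℝ => (t : ℂ) * y) (𝓝 1) (𝓝 (((1 : ℝ) : ℂ) * y)) :=
      (by fun_prop : Continuous fun t : ℝ => (t : ℂ) * y).tendsto 1
    simpa using this.mono_left nhdsWithin_le_nhds
  have hev : ∀ᶠ t : ℝ in 𝓝[<] 1, r < t ∧ t < 1 :=
    (eventually_nhdsWithin_of_eventually_nhds (eventually_gt_nhds hr1)).and self_mem_nhdsWithin
  have hnorm : ∀ t : ℝ, r < t → ‖(t : ℂ) * y‖ = t := fun t ht => by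
    rw [norm_mul, heq, mul_one, Complex.norm_real, Real.norm_of_nonneg (hr0.trans ht).le]
  have hnear : ∀ᶠ t : ℝ in 𝓝[<] 1, δ < ‖1 - (t : ℂ) * y‖ :=
    ((tendsto_const_nhds.sub hc).norm).eventually (lt_mem_nhds (by linarith))
  have hw : Tendsto (fun t : ℝ => (t : ℂ) * y) (𝓝[<] 1) (𝓝[slitAnnulus r δ] y) := by
    refine tendsto_nhdsWithin_iff.2 ⟨hc, ?_⟩
    filter_upwards [hev, hnear] with t ht hn
    exact ⟨by rw [hnorm t ht.1]; exact ht.1.le, by rw [hnorm t ht.1]; exact ht.2.le, hn.le⟩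
  refine tendsto_nhds_unique_of_eventuallyEq ((hcl y hmem).tendsto.comp hw)
    ((hcr y hmem).tendsto.comp hw) ?_
  filter_upwards [hev] with t ht
  exact appellIdentity_of_open_annulus hq h1 (by rw [hnorm t ht.1]; exact hr.trans ht.1)
    (by rw [hnorm t ht.1]; exact ht.2)

/-- The double-pole sum is invariant, while θ and y A both acquire the same nonzero factor −y⁻¹. -/
lemma appellIdentity_mul_iff {q y : ℂ} (hq : q ≠ 0) (hy : y ≠ 0) :
    AppellIdentity q (q * y) ↔ AppellIdentity q y := by
  rw [AppellIdentity, AppellIdentity, tsum_theta_mul hq hy, tsum_poleTerm_mul hq,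
    tsum_appellTerm_mul hq hy]
  have e : -eulerProd q ^ 3 * (q * y * (-(y * q)⁻¹ * ∑' l, appellTerm q y l)) =
      -y⁻¹ * (-eulerProd q ^ 3 * (y * ∑' l, appellTerm q y l)) := by
    field_simp
  rw [e, mul_assoc]
  exact mul_right_inj' (neg_ne_zero.2 (inv_ne_zero hy))

theorem appellIdentity {q y : ℂ} (hq : q ≠ 0) (h1 : ‖q‖ < 1) (hy : y ≠ 0)
    (hyq : ∀ k : ℤ, y * q ^ k ≠ 1) : AppellIdentity q y :=
  forall_of_fundamental_annulus hq h1 (fun _ hy => appellIdentity_mul_iff hq hy)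
    (fun _ => appellIdentity_of_annulus hq h1) hy hyq

/-! ### The constant coefficient and the odd-gap sum -/

/-- The term of `F₂⁽²⁾` at `s = p.1 + 1`, `r = p.1 + 2 + 2 * p.2`. -/
def oddGapTerm (q : ℂ) (p : ℕ × ℕ) : ℂ :=
  (-1) ^ p.1 * (p.1 + 1) * q ^ ((p.1 + 1) * (p.1 + 2) / 2 + p.2 * (p.1 + 1))

lemma add_le_triangle_add (s a : ℕ) : s + a ≤ (s + 1) * (s + 2) / 2 + a * (s + 1) := by
  have h1 : s ≤ (s + 1) * (s + 2) / 2 := by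
    rw [Nat.le_div_iff_mul_le two_pos]
    nlinarith
  nlinarith

lemma summable_oddGapTerm {q : ℂ} (h1 : ‖q‖ < 1) : Summable (oddGapTerm q) := by
  have hg := summable_geometric_of_lt_one (norm_nonneg q) h1
  have hs : Summable fun s : ℕ => ((s : ℝ) + 1) * ‖q‖ ^ s := by
    have := (summable_pow_mul_geometric_of_norm_lt_one 1 (r := ‖q‖) (by simpa)).add hg
    simpa [add_mul] using this
  refine Summable.of_norm_bounded (hs.mul_of_nonneg hg (fun s => by positivity)
    fun a => by positivity) fun p => ?_
  rw [oddGapTerm, norm_mul, norm_mul, norm_pow, norm_neg, norm_one, one_pow, one_mul, norm_pow,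
    mul_assoc, ← pow_add]
  have hn : ‖(p.1 : ℂ) + 1‖ = (p.1 : ℝ) + 1 := by
    exact_mod_cast Complex.norm_natCast (p.1 + 1)
  rw [hn]
  exact mul_le_mul_of_nonneg_left (pow_le_pow_of_le_one (norm_nonneg _) h1.le
    (add_le_triangle_add _ _)) (by positivity)

lemma thetaCoeff_neg_natCast_succ (q : ℂ) (s : ℕ) :
    thetaCoeff q (0 - ((s + 1 : ℕ) : ℤ)) = -((-1) ^ s * q ^ ((s + 1) * (s + 2) / 2)) := by
  have h : (0 - ((s + 1 : ℕ) : ℤ)) * (0 - ((s + 1 : ℕ) : ℤ) - 1) / 2 =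
      (((s + 1) * (s + 2) / 2 : ℕ) : ℤ) := by
    push_cast
    ring_nf
  rw [thetaCoeff, h, zpow_natCast, zero_sub, zpow_neg, ← inv_zpow, zpow_natCast, pow_succ]
  norm_num

lemma hasSum_oddGapTerm_row {q : ℂ} (h1 : ‖q‖ < 1) (s : ℕ) :
    HasSum (fun a => oddGapTerm q (s, a))
      (thetaCoeff q (0 - ((s + 1 : ℕ) : ℤ)) *
        (-(((s + 1 : ℕ) : ℤ) : ℂ) / (1 - q ^ ((s + 1 : ℕ) : ℤ)))) := by
  have hu : ‖q ^ (s + 1)‖ < 1 := by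
    rw [norm_pow]; exact pow_lt_one₀ (norm_nonneg _) h1 (by simp)
  refine (hasSum_geometric_add hu
    ((-1) ^ s * (s + 1) * q ^ ((s + 1) * (s + 2) / 2))).of_eq (fun a => ?_) ?_
  · rw [oddGapTerm, pow_add, ← pow_mul, mul_comm a]
    ring
  · rw [thetaCoeff_neg_natCast_succ, zpow_natCast]
    push_cast
    ring

/-- The constant in the Appell–Lerch identity is twice the odd-gap sum. -/
theorem convCoeff_zero {q : ℂ} (hq : q ≠ 0) (h1 : ‖q‖ < 1) :
    convCoeff q 0 = 2 * ∑' p, oddGapTerm q p := by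
  set t : ℤ → ℂ := fun m => thetaCoeff q (0 - m) * (-m / (1 - q ^ m)) with ht
  -- Evenness is the source of the factor 2: the positive and the negative m each contribute one
  -- copy of the odd-gap sum, and t 0 = 0.
  have hsymm : ∀ m, t (-m) = t m := by
    intro m
    rcases eq_or_ne m 0 with rfl | hm
    · simp
    have hz := zpow_ne_zero m hq
    have h2 := one_sub_zpow_ne_zero h1 hm
    simp only [ht, zero_sub, neg_neg]
    rw [thetaCoeff_neg hq, zpow_neg,
      show 1 - (q ^ m)⁻¹ = -(1 - q ^ m) / q ^ m by field_simp; ring]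
    push_cast
    field_simp
  have hF : HasSum (fun n : ℕ => t n) (∑' p, oddGapTerm q p) := by
    have h : HasSum (fun s : ℕ => t ((s + 1 : ℕ) : ℤ)) (∑' p, oddGapTerm q p) :=
      (summable_oddGapTerm h1).hasSum.prod_fiberwise (hasSum_oddGapTerm_row h1)
    have h2 := (hasSum_nat_add_iff (f := fun n : ℕ => t n) 1).1 h
    have h0 : t 0 = 0 := by simp [ht]
    simpa [h0] using h2
  have h := hF.of_nat_of_neg (by simpa only [hsymm] using hF)
  rw [convCoeff, h.tsum_eq]
  simp [ht]
  ring

/-- The parametrisation of `OddGapPair` by `s - 1` and half of `r - s - 1`. -/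
def oddGapEquiv : ℕ × ℕ ≃ HodgeElliptic.OddGapPair where
  toFun p := ⟨(p.1 + 2 + 2 * p.2, p.1 + 1), by simp, by simp; lia,
    ⟨p.2, by simp only; lia⟩⟩
  invFun x := (x.1.2 - 1, (x.1.1 - x.1.2) / 2)
  left_inv p := by ext <;> simp only <;> lia
  right_inv := by
    rintro ⟨⟨r, s⟩, h0, h1, k, hk⟩
    apply Subtype.ext
    simp only at *
    ext <;> simp only <;> lia

lemma f22Term_oddGapEquiv (τ : UpperHalfPlane) (p : ℕ × ℕ) :
    HodgeElliptic.f22Term τ (oddGapEquiv p) = oddGapTerm (HodgeElliptic.q τ) p := by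
  obtain ⟨s, a⟩ := p
  change (-1) ^ (s + 2 + 2 * a) * ((s + 1 : ℕ) : ℂ) *
    HodgeElliptic.q τ ^ ((s + 2 + 2 * a) * (s + 1) / 2) =
      (-1) ^ s * (s + 1) * HodgeElliptic.q τ ^ ((s + 1) * (s + 2) / 2 + a * (s + 1))
  rw [show (s + 2 + 2 * a) * (s + 1) = (s + 1) * (s + 2) + 2 * (a * (s + 1)) by ring,
    Nat.add_mul_div_left _ _ two_pos, pow_add, pow_add, pow_mul]
  push_cast
  norm_num

/-! ### Return to τ and z -/

lemma q_ne_zero (τ : UpperHalfPlane) : HodgeElliptic.q τ ≠ 0 := Complex.exp_ne_zero _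

lemma norm_q_lt_one (τ : UpperHalfPlane) : ‖HodgeElliptic.q τ‖ < 1 :=
  UpperHalfPlane.norm_exp_two_pi_I_lt_one τ

lemma y_mul_q_zpow_ne_one {τ : UpperHalfPlane} {z : ℂ}
    (hz : ∀ m n : ℤ, z ≠ (m : ℂ) + (n : ℂ) * (τ : ℂ)) (k : ℤ) :
    HodgeElliptic.y z * HodgeElliptic.q τ ^ k ≠ 1 := by
  intro h
  rw [HodgeElliptic.y, HodgeElliptic.q, ← Complex.exp_int_mul, ← Complex.exp_add,
    Complex.exp_eq_one_iff] at h
  obtain ⟨n, hn⟩ := h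
  refine hz n (-k) (mul_left_cancel₀ Complex.two_pi_I_ne_zero ?_)
  push_cast
  linear_combination hn

lemma tprod_theta_ne_zero {q y : ℂ} (hq : q ≠ 0) (h1 : ‖q‖ < 1)
    (hyq : ∀ k : ℤ, y * q ^ k ≠ 1) :
    ∏' n : ℕ, (1 - q ^ (n + 1)) * (1 - q ^ n * y) * (1 - q ^ (n + 1) * y⁻¹) ≠ 0 := by
  have h2 := multipliable_one_sub_pow_mul h1 y
  have h3 := multipliable_one_sub_pow_succ_mul h1 y⁻¹
  have h0 := ModularForm.multipliable_one_sub_pow h1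
  rw [(h0.mul h2).tprod_mul h3, h0.tprod_mul h2]
  refine mul_ne_zero (mul_ne_zero (eulerProd_ne_zero h1) ?_) ?_
  · simp only [sub_eq_add_neg]
    refine tprod_one_add_ne_zero_of_summable (fun n h => hyq n ?_)
      (summable_norm_geometric_mul h1 y)
    rw [zpow_natCast]
    linear_combination -h
  · simp only [sub_eq_add_neg]
    refine tprod_one_add_ne_zero_of_summable (fun n h => hyq (-(n + 1 : ℕ)) ?_)
      (by simpa [pow_succ, mul_assoc] using summable_norm_geometric_mul h1 (q * y⁻¹))
    have hp : q ^ (n + 1) ≠ 0 := pow_ne_zero _ hq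
    have h' : q ^ (n + 1) * y⁻¹ = 1 := by linear_combination -h
    rw [zpow_neg, zpow_natCast, ← div_eq_mul_inv, ← inv_div, inv_eq_one, div_eq_mul_inv, h']

lemma eta_pow_three (τ : UpperHalfPlane) :
    ModularForm.eta (τ : ℂ) ^ 3 =
      Complex.exp (2 * Real.pi * Complex.I * (τ : ℂ) / 8) * eulerProd (HodgeElliptic.q τ) ^ 3 := by
  rw [ModularForm.eta, mul_pow]
  congr 1
  · rw [Function.Periodic.qParam, ← Complex.exp_nat_mul]
    congr 1
    push_cast
    ring
  · congr 1
    exact tprod_congr fun n => by rw [ModularForm.eta_q_eq_pow]; rfl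

end AppellLerch

open AppellLerch in
theorem mainTheorem7 (τ : UpperHalfPlane) (z : ℂ)
    (hz : ∀ m n : ℤ, z ≠ (m : ℂ) + (n : ℂ) * (τ : ℂ)) :
    Multipliable (HodgeElliptic.thetaFactor τ z) ∧
    HodgeElliptic.theta1 τ z ≠ 0 ∧
    Summable (HodgeElliptic.sTerm 1 τ z) ∧
    Summable (HodgeElliptic.appellLerchTerm τ z) ∧
    Summable (HodgeElliptic.f22Term τ) ∧
    HodgeElliptic.s 1 τ z =
      HodgeElliptic.theta1 τ z / ModularForm.eta (τ : ℂ) ^ 3 * (2 * HodgeElliptic.F22 τ) +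
        HodgeElliptic.theta1 τ z * HodgeElliptic.mu τ z := by
  have hq := q_ne_zero τ
  have h1 := norm_q_lt_one τ
  have hy : HodgeElliptic.y z ≠ 0 := Complex.exp_ne_zero _
  have hyq := y_mul_q_zpow_ne_one hz
  have hθ : HodgeElliptic.theta1 τ z ≠ 0 :=
    mul_ne_zero (mul_ne_zero (mul_ne_zero Complex.I_ne_zero (Complex.exp_ne_zero _))
      (Complex.exp_ne_zero _)) (tprod_theta_ne_zero hq h1 hyq)
  have hsT : HodgeElliptic.sTerm 1 τ z = poleTerm (HodgeElliptic.q τ) (HodgeElliptic.y z) := by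
    funext i
    rw [HodgeElliptic.sTerm, poleTerm, sub_self, zero_sub]
  have hF : HodgeElliptic.F22 τ = ∑' p, oddGapTerm (HodgeElliptic.q τ) p := by
    rw [HodgeElliptic.F22, ← oddGapEquiv.tsum_eq]
    exact tsum_congr fun p => f22Term_oddGapEquiv τ p
  refine ⟨((ModularForm.multipliable_one_sub_pow h1).mul
      (multipliable_one_sub_pow_mul h1 _)).mul (multipliable_one_sub_pow_succ_mul h1 _), hθ,
    hsT ▸ summable_poleTerm hq h1 hy hyq, summable_appellTerm hq h1 hy hyq, ?_, ?_⟩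
  · refine oddGapEquiv.summable_iff.1 ((summable_oddGapTerm h1).congr fun p => ?_)
    exact (f22Term_oddGapEquiv τ p).symm
  -- The rest is bookkeeping of prefactors: q^{1/8} cancels between θ₁ and η³, and y = (e^{πiz})²
  -- turns y^{−1/2} · y into y^{1/2}.
  · have key := appellIdentity hq h1 hy hyq
    rw [AppellIdentity, convCoeff_zero hq h1, ← hF, ← tripleProduct hq h1 hy, ← hsT] at key
    change (∏' n, HodgeElliptic.thetaFactor τ z n) * _ =
      _ * (_ * ∑' l, HodgeElliptic.appellLerchTerm τ z l) at key
    have hyy : HodgeElliptic.y z = Complex.exp (Real.pi * Complex.I * z) ^ 2 := by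
      rw [HodgeElliptic.y, ← Complex.exp_nat_mul]
      congr 1
      push_cast
      ring
    have hφ := eulerProd_ne_zero h1
    have hE := Complex.exp_ne_zero (2 * Real.pi * Complex.I * (τ : ℂ) / 8)
    have hX := Complex.exp_ne_zero (Real.pi * Complex.I * z)
    have hμ : HodgeElliptic.theta1 τ z * HodgeElliptic.mu τ z = -Complex.I *
        Complex.exp (Real.pi * Complex.I * z) * ∑' l, HodgeElliptic.appellLerchTerm τ z l := by
      rw [HodgeElliptic.mu]
      field_simp
    rw [hμ, HodgeElliptic.s, eta_pow_three, HodgeElliptic.theta1, Complex.exp_neg]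
    rw [hyy] at key
    generalize Complex.exp (Real.pi * Complex.I * z) = X at key hX ⊢
    generalize Complex.exp (2 * Real.pi * Complex.I * (τ : ℂ) / 8) = E at hE ⊢
    field_simp
    linear_combination key

end
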